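/- Let $G_{29}=\langle s_1,s_2,s_3,s_4\rangle\subset \mathrm{GL}_4(\mathbb C)$ be the complex reflection group generated by $$s_1=\begin{pmatrix}0&1&0&0\\1&0&0&0\\0&0&1&0\\0&0&0&1\end{pmatrix},\quad s_2=\begin{pmatrix}1&0&0&0\\0&0&1&0\\0&1&0&0\\0&0&0&1\end{pmatrix},\quad s_3=\begin{pmatrix}0&-i&0&0\\i&0&0&0\\0&0&1&0\\0&0&0&1\end{pmatrix},\quad s_4=\frac12\begin{pmatrix}1&-1&-1&-1\\-1&1&-1&-1\\-1&-1&1&-1\\-1&-1&-1&1\end{pmatrix}.$$ A family of fundamental invariants of $G_{29}$ consists of four homogeneous, algebraically independent polynomials generating the $\mathbb C$-algebra $\mathbb C[x,y,z,t]^{G_{29}}$ of polynomial invariants of $G_{29}$; a fundamental invariant is a member of such a family. For a monomial $m$ in $x,y,z,t$, let $\Sigma_4(m)$ be the sum of all distinct monomials obtained from $m$ by permuting the four variables, and let $$f_1=\Sigma_4(x^4)-6\,\Sigma_4(x^2y^2),$$ $$f_2=\Sigma_4(x^8)+4\,\Sigma_4(x^6y^2)+6\,\Sigma_4(x^4y^4)-20\,\Sigma_4(x^4y^2z^2)+152\,x^2y^2z^2t^2,$$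 $$f_3=\Sigma_4(x^8y^2z^2)-\Sigma_4(x^6y^4z^2)+2\,\Sigma_4(x^6y^2z^2t^2)-2\,\Sigma_4(x^4y^4z^4)+2\,\Sigma_4(x^4y^4z^2t^2).$$ (1) Every fundamental invariant of degree $12$ of $G_{29}$ is an irreducible polynomial. (2) For all $\lambda,\mu\in\mathbb C$, the surface $\mathcal S_{12}^{\lambda,\mu}=\mathrm{Proj}\bigl(\mathbb C[x,y,z,t]/\langle f_3+\lambda f_2f_1+\mu f_1^3\rangle\bigr)$ is a reduced and irreducible scheme. -/

import Mathlib

open MvPolynomial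

/-! ### The reflection group `G₂₉` -/

namespace G29

noncomputable section

/-- The matrix of the reflection `s₁`. -/
def matS1 : Matrix (Fin 4) (Fin 4) ℂ :=
  !![0, 1, 0, 0; 1, 0, 0, 0; 0, 0, 1, 0; 0, 0, 0, 1]

/-- The matrix of the reflection `s₂`. -/
def matS2 : Matrix (Fin 4) (Fin 4) ℂ :=
  !![1, 0, 0, 0; 0, 0, 1, 0; 0, 1, 0, 0; 0, 0, 0, 1]

/-- The matrix of the reflection `s₃`. -/
def matS3 : Matrix (Fin 4) (Fin 4) ℂ :=
  !![0, -Complex.I, 0, 0; Complex.I, 0, 0, 0; 0, 0, 1, 0; 0, 0, 0, 1]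

/-- The matrix of the reflection `s₄`. -/
def matS4 : Matrix (Fin 4) (Fin 4) ℂ :=
  (1 / 2 : ℂ) • !![1, -1, -1, -1; -1, 1, -1, -1; -1, -1, 1, -1; -1, -1, -1, 1]

theorem matS1_mul_self : matS1 * matS1 = 1 := by
  ext i j
  fin_cases i <;> fin_cases j <;> simp [matS1, Matrix.mul_apply, Fin.sum_univ_four]

theorem matS2_mul_self : matS2 * matS2 = 1 := by
  ext i j
  fin_cases i <;> fin_cases j <;> simp [matS2, Matrix.mul_apply, Fin.sum_univ_four]

theorem matS3_mul_self : matS3 * matS3 = 1 := by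
  ext i j
  fin_cases i <;> fin_cases j <;> simp [matS3, Matrix.mul_apply, Fin.sum_univ_four]

theorem matS4_mul_self : matS4 * matS4 = 1 := by
  ext i j
  fin_cases i <;> fin_cases j <;>
    simp [matS4, Matrix.mul_apply, Fin.sum_univ_four, Matrix.cons_val] <;> norm_num

/-- A generating reflection, as an element of `GL₄(ℂ)`. -/
def s1 : GL (Fin 4) ℂ := ⟨matS1, matS1, matS1_mul_self, matS1_mul_self⟩

/-- A generating reflection, as an element of `GL₄(ℂ)`. -/
def s2 : GL (Fin 4) ℂ := ⟨matS2, matS2, matS2_mul_self, matS2_mul_self⟩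

/-- A generating reflection, as an element of `GL₄(ℂ)`. -/
def s3 : GL (Fin 4) ℂ := ⟨matS3, matS3, matS3_mul_self, matS3_mul_self⟩

/-- A generating reflection, as an element of `GL₄(ℂ)`. -/
def s4 : GL (Fin 4) ℂ := ⟨matS4, matS4, matS4_mul_self, matS4_mul_self⟩

/-- The complex reflection group `G₂₉ = ⟨s₁, s₂, s₃, s₄⟩ ⊆ GL₄(ℂ)`. -/
def group : Subgroup (GL (Fin 4) ℂ) := Subgroup.closure {s1, s2, s3, s4}

end

end G29

/-! ### Polynomial invariants -/

noncomputable section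

/-- The polynomial function `f ∘ g` on `ℂⁿ`: substitute `∑ j, g i j * X j` for `X i`. -/
def linSubst {n : ℕ} (g : GL (Fin n) ℂ) :
    MvPolynomial (Fin n) ℂ →ₐ[ℂ] MvPolynomial (Fin n) ℂ :=
  aeval fun i => ∑ j, C ((g : Matrix (Fin n) (Fin n) ℂ) i j) * X j

/-- The algebra `ℂ[V]^G` of polynomial invariants of `G ⊆ GL(V)`, `V = ℂⁿ`. -/
def polyInvariants {n : ℕ} (G : Subgroup (GL (Fin n) ℂ)) :
    Subalgebra ℂ (MvPolynomial (Fin n) ℂ) :=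
  ⨅ g ∈ G, AlgHom.equalizer (linSubst g) (AlgHom.id ℂ _)

theorem mem_polyInvariants {n : ℕ} {G : Subgroup (GL (Fin n) ℂ)}
    {f : MvPolynomial (Fin n) ℂ} : f ∈ polyInvariants G ↔ ∀ g ∈ G, linSubst g f = f := by
  simp [polyInvariants, Algebra.mem_iInf, AlgHom.mem_equalizer]

/-- `θ₁, …, θₙ` is a family of fundamental invariants of `G ⊆ GLₙ(ℂ)`: homogeneous, algebraically
independent polynomials generating the algebra of invariants of `G`. -/
structure IsFundamentalFamily {n : ℕ} (G : Subgroup (GL (Fin n) ℂ))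
    (θ : Fin n → MvPolynomial (Fin n) ℂ) : Prop where
  homogeneous : ∀ i, ∃ d, (θ i).IsHomogeneous d
  algebraicIndependent : AlgebraicIndependent ℂ θ
  adjoin_eq : Algebra.adjoin ℂ (Set.range θ) = polyInvariants G

/-- `F` is a fundamental invariant of degree `d` of `G`: it is homogeneous of degree `d` and
belongs to a family of fundamental invariants of `G`. -/
def IsFundamentalInvariant {n : ℕ} (G : Subgroup (GL (Fin n) ℂ)) (d : ℕ)
    (F : MvPolynomial (Fin n) ℂ) : Prop :=
  F.IsHomogeneous d ∧ ∃ θ, IsFundamentalFamily G θ ∧ F ∈ Set.range θ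

end

/-! ### The scheme `Proj (ℂ[V] / ⟨f⟩)` -/

section QuotientGrading

variable {R A : Type*} [CommRing R] [CommRing A] [Algebra R A] (𝒜 : ℕ → Submodule R A)

/-- The grading of `A ⧸ I` by the images of the graded pieces of `A`. -/
def quotientGrading (I : Ideal A) (i : ℕ) : Submodule R (A ⧸ I) :=
  (𝒜 i).map (Ideal.Quotient.mkₐ R I).toLinearMap

/-- The map on direct sums of graded pieces induced by `A → A ⧸ I`. -/
noncomputable def quotientGradingMap (I : Ideal A) :
    (DirectSum ℕ fun i => 𝒜 i) →ₗ[R] DirectSum ℕ fun i => quotientGrading 𝒜 I i :=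
  DirectSum.lmap fun i => (Ideal.Quotient.mkₐ R I).toLinearMap.restrict
    (fun _ hx => Submodule.mem_map_of_mem hx)

theorem coe_quotientGradingMap (I : Ideal A) (x : DirectSum ℕ fun i => 𝒜 i) :
    DirectSum.coeAddMonoidHom (quotientGrading 𝒜 I) (quotientGradingMap 𝒜 I x) =
      Ideal.Quotient.mk I (DirectSum.coeAddMonoidHom 𝒜 x) := by
  induction x using DirectSum.induction_on with
  | zero => simp
  | of _ x =>
    have : quotientGradingMap 𝒜 I (DirectSum.of _ _ x) =
        DirectSum.of (fun i => quotientGrading 𝒜 I i) _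
          ⟨Ideal.Quotient.mk I x, Submodule.mem_map_of_mem x.2⟩ :=
      DirectSum.lmap_lof _ _ _
    rw [this, DirectSum.coeAddMonoidHom_of, DirectSum.coeAddMonoidHom_of]
  | add x y hx hy => simp only [map_add, hx, hy]

theorem quotientGradingMap_surjective (I : Ideal A) :
    Function.Surjective (quotientGradingMap 𝒜 I) := by
  intro y
  induction y using DirectSum.induction_on with
  | zero => exact ⟨0, map_zero _⟩
  | of i y =>
    obtain ⟨_, a, ha, rfl⟩ := y
    exact ⟨DirectSum.of (fun i => 𝒜 i) i ⟨a, ha⟩, DirectSum.lmap_lof _ _ _⟩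
  | add y z hy hz =>
    obtain ⟨a, rfl⟩ := hy
    obtain ⟨b, rfl⟩ := hz
    exact ⟨a + b, map_add _ _ _⟩

variable [GradedAlgebra 𝒜]

theorem quotientGradingMap_decompose_eq_zero {I : Ideal A} (hI : I.IsHomogeneous 𝒜)
    {a : A} (ha : a ∈ I) : quotientGradingMap 𝒜 I (DirectSum.decompose 𝒜 a) = 0 := by
  refine DFinsupp.ext fun i => Subtype.ext ?_
  change Ideal.Quotient.mk I (DirectSum.decompose 𝒜 a i : A) = 0
  exact Ideal.Quotient.eq_zero_iff_mem.2 (hI i ha)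

/-- The quotient of a graded algebra by a homogeneous ideal is a graded algebra. -/
@[reducible]
noncomputable def quotientGradedAlgebra {I : Ideal A} (hI : I.IsHomogeneous 𝒜) :
    GradedAlgebra (quotientGrading 𝒜 I) where
  one_mem := ⟨1, SetLike.GradedOne.one_mem, map_one (Ideal.Quotient.mkₐ R I)⟩
  mul_mem := by
    rintro i j _ _ ⟨a, ha, rfl⟩ ⟨b, hb, rfl⟩
    exact ⟨a * b, SetLike.GradedMul.mul_mem ha hb, map_mul (Ideal.Quotient.mkₐ R I) _ _⟩
  decompose' q := quotientGradingMap 𝒜 I (DirectSum.decompose 𝒜 (Quotient.out q))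
  left_inv q := by
    rw [coe_quotientGradingMap]
    have := DirectSum.Decomposition.left_inv (ℳ := 𝒜) (Quotient.out q)
    refine (congrArg _ this).trans ?_
    exact Quotient.out_eq q
  right_inv y := by
    obtain ⟨x, rfl⟩ := quotientGradingMap_surjective 𝒜 I y
    rw [coe_quotientGradingMap]
    set a := DirectSum.coeAddMonoidHom 𝒜 x with ha
    have hx : DirectSum.decompose 𝒜 a = x := DirectSum.Decomposition.right_inv (ℳ := 𝒜) x
    have hout : Ideal.Quotient.mk I (Quotient.out (Ideal.Quotient.mk I a)) =
        Ideal.Quotient.mk I a := Quotient.out_eq _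
    have h0 := quotientGradingMap_decompose_eq_zero 𝒜 hI (Ideal.Quotient.eq.1 hout)
    rw [DirectSum.decompose_sub, map_sub, sub_eq_zero, hx] at h0
    exact h0

end QuotientGrading

noncomputable section

attribute [local instance] MvPolynomial.gradedAlgebra

/-- The scheme `𝒵(f) = Proj (ℂ[X₁, …, Xₙ] / ⟨f⟩)` of a homogeneous polynomial `f`. -/
def hypersurface {n d : ℕ} (f : MvPolynomial (Fin n) ℂ) (hf : f.IsHomogeneous d) :
    AlgebraicGeometry.Scheme :=
  letI := quotientGradedAlgebra (homogeneousSubmodule (Fin n) ℂ) (I := Ideal.span {f})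
    (Ideal.homogeneous_span _ _ fun _ hx => ⟨d, by
      rw [Set.mem_singleton_iff.1 hx]; exact (mem_homogeneousSubmodule d f).2 hf⟩)
  AlgebraicGeometry.Proj
    (quotientGrading (homogeneousSubmodule (Fin n) ℂ) (Ideal.span {f}))

end

/-! ### The invariant dodecics -/

namespace G29

noncomputable section

/-- `Σ₄(x^a y^b z^c t^d)`, for the exponent vector `e = (a, b, c, d)`: the sum of all the
(distinct) monomials obtained from it by permuting the four variables. -/
def sigma4 (e : Fin 4 → ℕ) : MvPolynomial (Fin 4) ℂ :=
  ∑ m ∈ Finset.univ.image (fun σ : Equiv.Perm (Fin 4) => e ∘ σ), ∏ i, X i ^ m i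

theorem sigma4_isHomogeneous (e : Fin 4 → ℕ) {d : ℕ} (h : ∑ i, e i = d) :
    (sigma4 e).IsHomogeneous d := by
  refine IsHomogeneous.sum _ _ _ fun m hm => ?_
  obtain ⟨σ, -, rfl⟩ := Finset.mem_image.1 hm
  have hs : ∑ i, (e ∘ σ) i = d := (Equiv.sum_comp σ e).trans h
  rw [← hs]
  refine IsHomogeneous.prod _ _ _ fun i _ => ?_
  simpa using (isHomogeneous_X ℂ i).pow ((e ∘ σ) i)

/-- The polynomial `f₁`, of degree `4`. -/
def f1 : MvPolynomial (Fin 4) ℂ :=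
  sigma4 ![4, 0, 0, 0] - C 6 * sigma4 ![2, 2, 0, 0]

/-- The polynomial `f₂`, of degree `8`. -/
def f2 : MvPolynomial (Fin 4) ℂ :=
  sigma4 ![8, 0, 0, 0] + C 4 * sigma4 ![6, 2, 0, 0] + C 6 * sigma4 ![4, 4, 0, 0]
    - C 20 * sigma4 ![4, 2, 2, 0] + C 152 * sigma4 ![2, 2, 2, 2]

/-- The polynomial `f₃`, of degree `12`. -/
def f3 : MvPolynomial (Fin 4) ℂ :=
  sigma4 ![8, 2, 2, 0] - sigma4 ![6, 4, 2, 0] + C 2 * sigma4 ![6, 2, 2, 2]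
    - C 2 * sigma4 ![4, 4, 4, 0] + C 2 * sigma4 ![4, 4, 2, 2]

theorem f1_isHomogeneous : f1.IsHomogeneous 4 :=
  (sigma4_isHomogeneous _ (by decide)).sub ((sigma4_isHomogeneous _ (by decide)).C_mul _)

theorem f2_isHomogeneous : f2.IsHomogeneous 8 :=
  ((((sigma4_isHomogeneous _ (by decide)).add
    ((sigma4_isHomogeneous _ (by decide)).C_mul _)).add
    ((sigma4_isHomogeneous _ (by decide)).C_mul _)).sub
    ((sigma4_isHomogeneous _ (by decide)).C_mul _)).add
    ((sigma4_isHomogeneous _ (by decide)).C_mul _)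

theorem f3_isHomogeneous : f3.IsHomogeneous 12 :=
  ((((sigma4_isHomogeneous _ (by decide)).sub
    (sigma4_isHomogeneous _ (by decide))).add
    ((sigma4_isHomogeneous _ (by decide)).C_mul _)).sub
    ((sigma4_isHomogeneous _ (by decide)).C_mul _)).add
    ((sigma4_isHomogeneous _ (by decide)).C_mul _)

/-- The dodecic form `f₃ + l f₂ f₁ + m f₁³`. -/
def dodecic (l m : ℂ) : MvPolynomial (Fin 4) ℂ := f3 + C l * (f2 * f1) + C m * f1 ^ 3

theorem dodecic_isHomogeneous (l m : ℂ) : (dodecic l m).IsHomogeneous 12 :=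
  (f3_isHomogeneous.add ((f2_isHomogeneous.mul f1_isHomogeneous).C_mul l)).add
    ((f1_isHomogeneous.pow 3).C_mul m)

/-- The surface `𝒮₁₂^{l,m} = 𝒵(f₃ + l f₂ f₁ + m f₁³)` in `ℙ³(ℂ)`. -/
def surface (l m : ℂ) : AlgebraicGeometry.Scheme :=
  hypersurface (dodecic l m) (dodecic_isHomogeneous l m)

end

end G29

/-! The matrix `matP` conjugates the group to a form in which `f1`, `f2`, `f3` are invariant: sign
changes and permutations preserve them because they are polynomials in the elementary symmetric
functions of the squares. The remaining generator, `matR`, is seen to preserve them in the original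
coordinates, where they become polynomials in the symmetric functions of the fourth powers and in
`xyzt`.

Irreducibility of a dodecic `F = f3 + l f2 f1 + m f1³` rests on the claim that each irreducible
factor `p` of `F` is fixed by the reflection `t ↦ -t` (`fixesFactors_sgn`). The generating
reflections are conjugate through braid relations, so `p` is then fixed by all of them, hence by
their products. Two products act as scalars at the point `(1, w, w², 0)`, with `w` a primitive cube
root of unity: a 3-cycle multiplies it by `w²`, and the fifth power of a Coxeter element is `i`
times the identity. Since `F`, and so `p`, is nonzero there, the degree of `p` is divisible by 3 and
by 4; it is 12, and `p` is all of `F` up to a scalar.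

For the claim, suppose `p` is not associated to its image under `t ↦ -t`. Both are then factors of
`F`, and they agree on the plane `t = 0`. The form `p` vanishes somewhere on the curve `t = f1 = 0`,
where `F` reduces to `f3 = (xyz)² K`. If `xyz ≠ 0` at such a zero, `F` is singular in the plane
there, but `K = 0` is transverse to the curve (`transverse_aux`). So some coordinate vanishes, say
`x = 0`. There `F` has order exactly 2 along the curve (`exists_germ_order`), which leaves room for
no factor besides `p` and its image. Every symmetry fixing the point therefore permutes these two up
to scalars; the scalars for `x ↦ -x` and `x ↔ t` are computed, and they force `p` to be a linear
form `x + k t` with `k² = -1`, up to a scalar, which does not divide `F`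
(`MovedFactor.eval_zero_ne`).

For fundamental invariants, the monomial symmetries and four evaluations show that every invariant
of degree 12 is a combination of `f3`, `f2 f1`, `f1³` after `matP`. A fundamental one must involve
`f3`, since otherwise it is a product of invariants of degrees 4 and 8. The statement on schemes
follows because `Proj` of a graded domain with nonzero irrelevant ideal is reduced and irreducible.
-/

/-! ### Common zeros of few forms -/

section Height

/-- The prime ideal of the coordinate subspace `X i = 0`, `i < k`. -/
noncomputable def coordIdeal (n k : ℕ) : Ideal (MvPolynomial (Fin n) ℂ) :=
  RingHom.ker (aeval (fun i : Fin n => if (i : ℕ) < k then (0 : MvPolynomial (Fin n) ℂ) else X i) :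
    MvPolynomial (Fin n) ℂ →ₐ[ℂ] MvPolynomial (Fin n) ℂ)

instance coordIdeal_isPrime (n k : ℕ) : (coordIdeal n k).IsPrime := RingHom.ker_isPrime _

theorem coordIdeal_lt_succ {n k : ℕ} (hk : k < n) : coordIdeal n k < coordIdeal n (k + 1) := by
  refine lt_of_le_of_ne ?_ ?_
  · intro p hp
    rw [coordIdeal, RingHom.mem_ker] at hp ⊢
    have : (aeval (fun i : Fin n => if (i : ℕ) < k + 1 then (0 : MvPolynomial (Fin n) ℂ) else X i) :
        MvPolynomial (Fin n) ℂ →ₐ[ℂ] MvPolynomial (Fin n) ℂ) =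
        (aeval (fun i : Fin n => if (i : ℕ) < k + 1 then (0 : MvPolynomial (Fin n) ℂ) else X i)).comp
        (aeval (fun i : Fin n => if (i : ℕ) < k then (0 : MvPolynomial (Fin n) ℂ) else X i)) := by
      ext1 i
      by_cases h1 : (i : ℕ) < k
      · simp [h1, h1.le]
      · simp [h1]
    rw [this]
    simp only [AlgHom.coe_comp, Function.comp_apply]
    rw [hp, map_zero]
  · intro h
    have h1 : (X ⟨k, hk⟩ : MvPolynomial (Fin n) ℂ) ∈ coordIdeal n (k + 1) := by
      simp [coordIdeal, RingHom.mem_ker]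
    rw [← h] at h1
    simp [coordIdeal, RingHom.mem_ker] at h1

/-- The coordinate primes form a strictly increasing chain, each step of which raises the height by
at least one. At `k = n` this bounds below the height of the maximal ideal of the origin. -/
theorem le_height_coordIdeal {n k : ℕ} (hk : k ≤ n) : (k : ℕ∞) ≤ (coordIdeal n k).height := by
  induction k with
  | zero => simp
  | succ k ih =>
    push_cast
    exact (add_le_add_left (ih (by omega)) 1).trans
      (Ideal.height_add_one_le_of_lt_of_isPrime (coordIdeal_lt_succ hk))

theorem aeval_ite_lt_eq_C (n : ℕ) (p : MvPolynomial (Fin n) ℂ) :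
    aeval (fun i : Fin n => if (i : ℕ) < n then (0 : MvPolynomial (Fin n) ℂ) else X i) p =
      C (eval 0 p) := by
  have : (aeval (fun i : Fin n => if (i : ℕ) < n then (0 : MvPolynomial (Fin n) ℂ) else X i) :
      MvPolynomial (Fin n) ℂ →ₐ[ℂ] MvPolynomial (Fin n) ℂ) =
      (Algebra.ofId ℂ _).comp (aeval (0 : Fin n → ℂ)) := by
    ext1 i
    simp
  rw [this]
  simp [Algebra.ofId_apply]

theorem mem_coordIdeal_self {n : ℕ} {p : MvPolynomial (Fin n) ℂ} :
    p ∈ coordIdeal n n ↔ eval 0 p = 0 := by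
  rw [coordIdeal, RingHom.mem_ker, aeval_ite_lt_eq_C]
  simp

end Height

theorem MvPolynomial.IsHomogeneous.eval_zero_eq_zero {n d : ℕ} {p : MvPolynomial (Fin n) ℂ}
    (hp : p.IsHomogeneous d) (hd : d ≠ 0) : eval 0 p = 0 := by
  have h : constantCoeff p = 0 := by
    rw [constantCoeff_eq]
    exact hp.coeff_eq_zero (by simpa using hd.symm)
  rw [← h, MvPolynomial.eval_zero]

/-- Fewer than `n` forms of positive degree in `n` variables have a common nontrivial zero. -/
theorem exists_ne_zero_forall_eval_eq_zero {n : ℕ} (s : Finset (MvPolynomial (Fin n) ℂ))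
    (hs : s.card < n) (h0 : ∀ p ∈ s, eval 0 p = 0) :
    ∃ v : Fin n → ℂ, v ≠ 0 ∧ ∀ p ∈ s, eval v p = 0 := by
  by_contra! hcon
  have hle : Ideal.span (s : Set (MvPolynomial (Fin n) ℂ)) ≤ coordIdeal n n :=
    Ideal.span_le.2 fun p hp => mem_coordIdeal_self.2 (h0 p hp)
  -- Nullstellensatz: if the origin is the only common zero, every polynomial vanishing at the
  -- origin lies in the radical of the ideal.
  have hrad : coordIdeal n n ≤ (Ideal.span (s : Set (MvPolynomial (Fin n) ℂ))).radical := by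
    rw [← vanishingIdeal_zeroLocus_eq_radical (K := ℂ)]
    intro p hp
    rw [mem_vanishingIdeal_iff]
    intro v hv
    have : v = 0 := by
      by_contra hv0
      obtain ⟨q, hq, hqv⟩ := hcon v hv0
      exact hqv (by simpa [coe_aeval_eq_eval] using hv q (Ideal.subset_span hq))
    subst this
    simpa [coe_aeval_eq_eval] using mem_coordIdeal_self.1 hp
  have hmin : coordIdeal n n ∈ (Ideal.span (s : Set (MvPolynomial (Fin n) ℂ))).minimalPrimes := by
    refine ⟨⟨inferInstance, hle⟩, fun J hJ _ => ?_⟩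
    exact hrad.trans (hJ.1.radical_le_iff.2 hJ.2)
  -- Krull's height theorem bounds the height by the number of generators, against the lower bound
  -- `n`.
  have h1 := Ideal.height_le_card_of_mem_minimalPrimes_span_finset hmin
  have h2 := (le_height_coordIdeal le_rfl).trans h1
  exact absurd (Nat.cast_le.1 h2) (by omega)

/-! ### Factors of forms, and elementary facts on forms -/

section GradingHom

variable {σ : Type*}

/-- The homomorphism `X i ↦ X i * T`; the coefficients of the image of `p` as a polynomial in `T`
are the homogeneous components of `p`. -/
noncomputable def gradingHom : MvPolynomial σ ℂ →ₐ[ℂ] Polynomial (MvPolynomial σ ℂ) :=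
  MvPolynomial.aeval fun i => Polynomial.C (X i) * Polynomial.X

theorem gradingHom_monomial (u : σ →₀ ℕ) (a : ℂ) :
    gradingHom (monomial u a) = Polynomial.C (monomial u a) * Polynomial.X ^ u.degree := by
  have h : monomial u a = C a * ∏ i ∈ u.support, X i ^ u i := by rw [monomial_eq]; rfl
  rw [h, Finsupp.degree_apply, ← Finset.prod_pow_eq_pow_sum]
  simp only [gradingHom, map_mul, map_prod, map_pow, aeval_X, algHom_C, mul_pow,
    Finset.prod_mul_distrib, Polynomial.algebraMap_apply, MvPolynomial.algebraMap_eq, mul_assoc]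

theorem coeff_gradingHom (r : MvPolynomial σ ℂ) (k : ℕ) :
    (gradingHom r).coeff k = homogeneousComponent k r := by
  induction r using MvPolynomial.induction_on' with
  | monomial u a =>
    rw [gradingHom_monomial, Polynomial.coeff_C_mul, Polynomial.coeff_X_pow,
      homogeneousComponent_of_mem ((mem_homogeneousSubmodule _ _).2 (isHomogeneous_monomial a rfl))]
    simp
  | add p q hp hq => simp [hp, hq]

theorem gradingHom_injective {r : MvPolynomial σ ℂ} (hr : gradingHom r = 0) : r = 0 := by
  rw [← sum_homogeneousComponent r]
  refine Finset.sum_eq_zero fun k _ => ?_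
  rw [← coeff_gradingHom, hr, Polynomial.coeff_zero]

theorem gradingHom_of_isHomogeneous {r : MvPolynomial σ ℂ} {d : ℕ} (h : r.IsHomogeneous d) :
    gradingHom r = Polynomial.C r * Polynomial.X ^ d := by
  ext1 k
  rw [coeff_gradingHom, homogeneousComponent_of_mem ((mem_homogeneousSubmodule _ _).2 h),
    Polynomial.coeff_C_mul, Polynomial.coeff_X_pow]
  simp

/-- The extreme exponents of `T` in `gradingHom r` are the extreme degrees of the homogeneous
components of `r`; if they agree, a single component remains. -/
theorem isHomogeneous_of_natTrailingDegree_eq {r : MvPolynomial σ ℂ}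
    (hr : (gradingHom r).natTrailingDegree = (gradingHom r).natDegree) :
    r.IsHomogeneous (gradingHom r).natDegree := by
  have hz : ∀ k, k ≠ (gradingHom r).natDegree → homogeneousComponent k r = 0 := by
    intro k hk
    rw [← coeff_gradingHom]
    rcases lt_or_gt_of_ne hk with h | h
    · exact Polynomial.coeff_eq_zero_of_lt_natTrailingDegree (hr ▸ h)
    · exact Polynomial.coeff_eq_zero_of_natDegree_lt h
  have : homogeneousComponent (gradingHom r).natDegree r = r := by
    conv_rhs => rw [← sum_homogeneousComponent r]
    by_cases hmem : (gradingHom r).natDegree ∈ Finset.range (r.totalDegree + 1)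
    · rw [Finset.sum_eq_single_of_mem _ hmem fun k _ hk => hz k hk]
    · rw [Finset.sum_eq_zero fun k hk => hz k fun h => hmem (h ▸ hk)]
      exact homogeneousComponent_eq_zero _ _ (by simpa using hmem)
  rw [← this]
  have h2 := homogeneousComponent_isHomogeneous (gradingHom r).natDegree r
  rwa [this] at h2 ⊢

end GradingHom

/-- A factor of a nonzero form is a form. -/
theorem MvPolynomial.IsHomogeneous.exists_of_mul {σ : Type*} {d : ℕ}
    {p q : MvPolynomial σ ℂ} (h : (p * q).IsHomogeneous d) (h0 : p * q ≠ 0) :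
    ∃ m n, p.IsHomogeneous m ∧ q.IsHomogeneous n ∧ m + n = d := by
  have hp0 : gradingHom p ≠ 0 := fun h => h0 (by rw [gradingHom_injective h, zero_mul])
  have hq0 : gradingHom q ≠ 0 := fun h => h0 (by rw [gradingHom_injective h, mul_zero])
  have hpq := gradingHom_of_isHomogeneous h
  have hdeg : (gradingHom p).natDegree + (gradingHom q).natDegree = d := by
    rw [← Polynomial.natDegree_mul hp0 hq0, ← map_mul, hpq, Polynomial.natDegree_C_mul_X_pow _ _ h0]
  -- Top degrees and trailing degrees both add up to `d`, while each trailing degree is at most the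
  -- top degree, so they agree factor by factor.
  have htr : (gradingHom p).natTrailingDegree + (gradingHom q).natTrailingDegree = d := by
    rw [← Polynomial.natTrailingDegree_mul hp0 hq0, ← map_mul, hpq,
      Polynomial.C_mul_X_pow_eq_monomial, Polynomial.natTrailingDegree_monomial h0]
  have h1 := Polynomial.natTrailingDegree_le_natDegree (gradingHom p)
  have h2 := Polynomial.natTrailingDegree_le_natDegree (gradingHom q)
  exact ⟨_, _, isHomogeneous_of_natTrailingDegree_eq (by omega),
    isHomogeneous_of_natTrailingDegree_eq (by omega), hdeg⟩

/-- A polynomial vanishing on the coordinate hyperplane `X i = 0` is divisible by `X i`. -/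
theorem MvPolynomial.X_dvd_of_aeval_update_eq_zero {σ : Type*} [DecidableEq σ] (i : σ)
    (p : MvPolynomial σ ℂ) (h : aeval (Function.update X i (0 : MvPolynomial σ ℂ)) p = 0) :
    X i ∣ p := by
  -- Setting `X i` to zero changes nothing modulo `X i`.
  have : (Ideal.Quotient.mkₐ ℂ (Ideal.span {(X i : MvPolynomial σ ℂ)})) =
      (Ideal.Quotient.mkₐ ℂ (Ideal.span {(X i : MvPolynomial σ ℂ)})).comp
        (aeval (Function.update X i (0 : MvPolynomial σ ℂ))) := by
    ext1 j
    by_cases hj : j = i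
    · subst hj
      simp
    · simp [hj]
  have h1 := DFunLike.congr_fun this p
  rw [AlgHom.comp_apply, h, map_zero] at h1
  exact Ideal.mem_span_singleton.1 (Ideal.Quotient.eq_zero_iff_mem.1 h1)

theorem MvPolynomial.exists_C_mul_of_associated {σ : Type*} {p q : MvPolynomial σ ℂ}
    (h : Associated p q) : ∃ c : ℂ, c ≠ 0 ∧ q = C c * p := by
  obtain ⟨u, rfl⟩ := h
  obtain ⟨c, hc, hcu⟩ := isUnit_iff_eq_C_of_isReduced.1 u.isUnit
  exact ⟨c, hc.ne_zero, by rw [hcu, mul_comm]⟩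

theorem MvPolynomial.IsHomogeneous.eval_smul_eq {n d : ℕ} {p : MvPolynomial (Fin n) ℂ}
    (hp : p.IsHomogeneous d) (c : ℂ) (v : Fin n → ℂ) :
    eval (fun i => c * v i) p = c ^ d * eval v p := by
  rw [eval_eq', eval_eq', Finset.mul_sum]
  refine Finset.sum_congr rfl fun m hm => ?_
  have : ∑ i, m i = d := by
    rw [← hp (mem_support_iff.1 hm), Finsupp.weight_apply, Finsupp.sum_fintype _ _ (by simp)]
    simp
  simp only [mul_pow, Finset.prod_mul_distrib, Finset.prod_pow_eq_pow_sum, this]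
  ring

theorem MvPolynomial.IsHomogeneous.eval_add_of_one {n : ℕ} {p : MvPolynomial (Fin n) ℂ}
    (hp : p.IsHomogeneous 1) (v w : Fin n → ℂ) : eval (v + w) p = eval v p + eval w p := by
  have h : p ∈ homogeneousSubmodule (Fin n) ℂ 1 := hp
  rw [homogeneousSubmodule_one_eq_span_X] at h
  clear hp
  induction h using Submodule.span_induction with
  | mem x hx => obtain ⟨i, rfl⟩ := hx; simp
  | zero => simp
  | add x y _ _ hx hy => simp only [map_add, hx, hy]; ring
  | smul a x _ hx => simp only [smul_eval, hx]; ring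

/-! ### The three forms in the symmetric functions of the squares -/

namespace G29

section Formulas

variable {A : Type*} [CommRing A] [Algebra ℂ A]

/-- Elementary symmetric polynomial of degree `1` in the squares of four elements. -/
def e1 (x y z t : A) : A := x ^ 2 + y ^ 2 + z ^ 2 + t ^ 2

/-- Elementary symmetric polynomial of degree `2` in the squares of four elements. -/
def e2 (x y z t : A) : A :=
  (x * y) ^ 2 + (x * z) ^ 2 + (x * t) ^ 2 + (y * z) ^ 2 + (y * t) ^ 2 + (z * t) ^ 2

/-- Elementary symmetric polynomial of degree `3` in the squares of four elements. -/
def e3 (x y z t : A) : A :=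
  (x * y * z) ^ 2 + (x * y * t) ^ 2 + (x * z * t) ^ 2 + (y * z * t) ^ 2

/-- Elementary symmetric polynomial of degree `4` in the squares of four elements. -/
def e4 (x y z t : A) : A := (x * y * z * t) ^ 2

theorem aeval_sigma4_4000 (x y z t : A) :
    aeval ![x, y, z, t] (sigma4 ![4, 0, 0, 0]) =
      x ^ 4 + y ^ 4 + z ^ 4 +
      t ^ 4 := by
  have h : Finset.univ.image (fun σ : Equiv.Perm (Fin 4) => (![4, 0, 0, 0] : Fin 4 → ℕ) ∘ σ) =
      {![4, 0, 0, 0], ![0, 4, 0, 0], ![0, 0, 4, 0], ![0, 0, 0, 4]} := by decide +kernel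
  rw [sigma4, h]
  repeat rw [Finset.sum_insert (by decide)]
  simp only [Finset.sum_singleton, map_add, map_pow, aeval_X, Fin.prod_univ_four,
    Matrix.cons_val, pow_zero, mul_one, one_mul, add_assoc]

theorem aeval_sigma4_2200 (x y z t : A) :
    aeval ![x, y, z, t] (sigma4 ![2, 2, 0, 0]) =
      x ^ 2 * y ^ 2 + x ^ 2 * z ^ 2 + x ^ 2 * t ^ 2 +
      y ^ 2 * z ^ 2 + y ^ 2 * t ^ 2 + z ^ 2 * t ^ 2 := by
  have h : Finset.univ.image (fun σ : Equiv.Perm (Fin 4) => (![2, 2, 0, 0] : Fin 4 → ℕ) ∘ σ) =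
      {![2, 2, 0, 0], ![2, 0, 2, 0], ![2, 0, 0, 2], ![0, 2, 2, 0],
      ![0, 2, 0, 2], ![0, 0, 2, 2]} := by decide +kernel
  rw [sigma4, h]
  repeat rw [Finset.sum_insert (by decide)]
  simp only [Finset.sum_singleton, map_add, map_mul, map_pow, aeval_X, Fin.prod_univ_four,
    Matrix.cons_val, pow_zero, mul_one, one_mul, add_assoc]

theorem aeval_sigma4_8000 (x y z t : A) :
    aeval ![x, y, z, t] (sigma4 ![8, 0, 0, 0]) =
      x ^ 8 + y ^ 8 + z ^ 8 +
      t ^ 8 := by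
  have h : Finset.univ.image (fun σ : Equiv.Perm (Fin 4) => (![8, 0, 0, 0] : Fin 4 → ℕ) ∘ σ) =
      {![8, 0, 0, 0], ![0, 8, 0, 0], ![0, 0, 8, 0], ![0, 0, 0, 8]} := by decide +kernel
  rw [sigma4, h]
  repeat rw [Finset.sum_insert (by decide)]
  simp only [Finset.sum_singleton, map_add, map_pow, aeval_X, Fin.prod_univ_four,
    Matrix.cons_val, pow_zero, mul_one, one_mul, add_assoc]

theorem aeval_sigma4_6200 (x y z t : A) :
    aeval ![x, y, z, t] (sigma4 ![6, 2, 0, 0]) =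
      x ^ 6 * y ^ 2 + x ^ 6 * z ^ 2 + x ^ 6 * t ^ 2 +
      x ^ 2 * y ^ 6 + x ^ 2 * z ^ 6 + x ^ 2 * t ^ 6 +
      y ^ 6 * z ^ 2 + y ^ 6 * t ^ 2 + y ^ 2 * z ^ 6 +
      y ^ 2 * t ^ 6 + z ^ 6 * t ^ 2 + z ^ 2 * t ^ 6 := by
  have h : Finset.univ.image (fun σ : Equiv.Perm (Fin 4) => (![6, 2, 0, 0] : Fin 4 → ℕ) ∘ σ) =
      {![6, 2, 0, 0], ![6, 0, 2, 0], ![6, 0, 0, 2], ![2, 6, 0, 0],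
      ![2, 0, 6, 0], ![2, 0, 0, 6], ![0, 6, 2, 0], ![0, 6, 0, 2],
      ![0, 2, 6, 0], ![0, 2, 0, 6], ![0, 0, 6, 2], ![0, 0, 2, 6]} := by decide +kernel
  rw [sigma4, h]
  repeat rw [Finset.sum_insert (by decide)]
  simp only [Finset.sum_singleton, map_add, map_mul, map_pow, aeval_X, Fin.prod_univ_four,
    Matrix.cons_val, pow_zero, mul_one, one_mul, add_assoc]

theorem aeval_sigma4_4400 (x y z t : A) :
    aeval ![x, y, z, t] (sigma4 ![4, 4, 0, 0]) =
      x ^ 4 * y ^ 4 + x ^ 4 * z ^ 4 + x ^ 4 * t ^ 4 +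
      y ^ 4 * z ^ 4 + y ^ 4 * t ^ 4 + z ^ 4 * t ^ 4 := by
  have h : Finset.univ.image (fun σ : Equiv.Perm (Fin 4) => (![4, 4, 0, 0] : Fin 4 → ℕ) ∘ σ) =
      {![4, 4, 0, 0], ![4, 0, 4, 0], ![4, 0, 0, 4], ![0, 4, 4, 0],
      ![0, 4, 0, 4], ![0, 0, 4, 4]} := by decide +kernel
  rw [sigma4, h]
  repeat rw [Finset.sum_insert (by decide)]
  simp only [Finset.sum_singleton, map_add, map_mul, map_pow, aeval_X, Fin.prod_univ_four,
    Matrix.cons_val, pow_zero, mul_one, one_mul, add_assoc]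

theorem aeval_sigma4_4220 (x y z t : A) :
    aeval ![x, y, z, t] (sigma4 ![4, 2, 2, 0]) =
      x ^ 4 * y ^ 2 * z ^ 2 + x ^ 4 * y ^ 2 * t ^ 2 + x ^ 4 * z ^ 2 * t ^ 2 +
      x ^ 2 * y ^ 4 * z ^ 2 + x ^ 2 * y ^ 4 * t ^ 2 + x ^ 2 * y ^ 2 * z ^ 4 +
      x ^ 2 * y ^ 2 * t ^ 4 + x ^ 2 * z ^ 4 * t ^ 2 + x ^ 2 * z ^ 2 * t ^ 4 +
      y ^ 4 * z ^ 2 * t ^ 2 + y ^ 2 * z ^ 4 * t ^ 2 + y ^ 2 * z ^ 2 * t ^ 4 := by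
  have h : Finset.univ.image (fun σ : Equiv.Perm (Fin 4) => (![4, 2, 2, 0] : Fin 4 → ℕ) ∘ σ) =
      {![4, 2, 2, 0], ![4, 2, 0, 2], ![4, 0, 2, 2], ![2, 4, 2, 0],
      ![2, 4, 0, 2], ![2, 2, 4, 0], ![2, 2, 0, 4], ![2, 0, 4, 2],
      ![2, 0, 2, 4], ![0, 4, 2, 2], ![0, 2, 4, 2], ![0, 2, 2, 4]} := by decide +kernel
  rw [sigma4, h]
  repeat rw [Finset.sum_insert (by decide)]
  simp only [Finset.sum_singleton, map_add, map_mul, map_pow, aeval_X, Fin.prod_univ_four,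
    Matrix.cons_val, pow_zero, mul_one, one_mul, add_assoc]

theorem aeval_sigma4_2222 (x y z t : A) :
    aeval ![x, y, z, t] (sigma4 ![2, 2, 2, 2]) =
      x ^ 2 * y ^ 2 * z ^ 2 * t ^ 2 := by
  have h : Finset.univ.image (fun σ : Equiv.Perm (Fin 4) => (![2, 2, 2, 2] : Fin 4 → ℕ) ∘ σ) =
      {![2, 2, 2, 2]} := by decide +kernel
  rw [sigma4, h]
  
  simp only [Finset.sum_singleton, map_mul, map_pow, aeval_X, Fin.prod_univ_four,
    Matrix.cons_val]

theorem aeval_sigma4_8220 (x y z t : A) :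
    aeval ![x, y, z, t] (sigma4 ![8, 2, 2, 0]) =
      x ^ 8 * y ^ 2 * z ^ 2 + x ^ 8 * y ^ 2 * t ^ 2 + x ^ 8 * z ^ 2 * t ^ 2 +
      x ^ 2 * y ^ 8 * z ^ 2 + x ^ 2 * y ^ 8 * t ^ 2 + x ^ 2 * y ^ 2 * z ^ 8 +
      x ^ 2 * y ^ 2 * t ^ 8 + x ^ 2 * z ^ 8 * t ^ 2 + x ^ 2 * z ^ 2 * t ^ 8 +
      y ^ 8 * z ^ 2 * t ^ 2 + y ^ 2 * z ^ 8 * t ^ 2 + y ^ 2 * z ^ 2 * t ^ 8 := by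
  have h : Finset.univ.image (fun σ : Equiv.Perm (Fin 4) => (![8, 2, 2, 0] : Fin 4 → ℕ) ∘ σ) =
      {![8, 2, 2, 0], ![8, 2, 0, 2], ![8, 0, 2, 2], ![2, 8, 2, 0],
      ![2, 8, 0, 2], ![2, 2, 8, 0], ![2, 2, 0, 8], ![2, 0, 8, 2],
      ![2, 0, 2, 8], ![0, 8, 2, 2], ![0, 2, 8, 2], ![0, 2, 2, 8]} := by decide +kernel
  rw [sigma4, h]
  repeat rw [Finset.sum_insert (by decide)]
  simp only [Finset.sum_singleton, map_add, map_mul, map_pow, aeval_X, Fin.prod_univ_four,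
    Matrix.cons_val, pow_zero, mul_one, one_mul, add_assoc]

theorem aeval_sigma4_6420 (x y z t : A) :
    aeval ![x, y, z, t] (sigma4 ![6, 4, 2, 0]) =
      x ^ 6 * y ^ 4 * z ^ 2 + x ^ 6 * y ^ 4 * t ^ 2 + x ^ 6 * y ^ 2 * z ^ 4 +
      x ^ 6 * y ^ 2 * t ^ 4 + x ^ 6 * z ^ 4 * t ^ 2 + x ^ 6 * z ^ 2 * t ^ 4 +
      x ^ 4 * y ^ 6 * z ^ 2 + x ^ 4 * y ^ 6 * t ^ 2 + x ^ 4 * y ^ 2 * z ^ 6 +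
      x ^ 4 * y ^ 2 * t ^ 6 + x ^ 4 * z ^ 6 * t ^ 2 + x ^ 4 * z ^ 2 * t ^ 6 +
      x ^ 2 * y ^ 6 * z ^ 4 + x ^ 2 * y ^ 6 * t ^ 4 + x ^ 2 * y ^ 4 * z ^ 6 +
      x ^ 2 * y ^ 4 * t ^ 6 + x ^ 2 * z ^ 6 * t ^ 4 + x ^ 2 * z ^ 4 * t ^ 6 +
      y ^ 6 * z ^ 4 * t ^ 2 + y ^ 6 * z ^ 2 * t ^ 4 + y ^ 4 * z ^ 6 * t ^ 2 +
      y ^ 4 * z ^ 2 * t ^ 6 + y ^ 2 * z ^ 6 * t ^ 4 + y ^ 2 * z ^ 4 * t ^ 6 := by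
  have h : Finset.univ.image (fun σ : Equiv.Perm (Fin 4) => (![6, 4, 2, 0] : Fin 4 → ℕ) ∘ σ) =
      {![6, 4, 2, 0], ![6, 4, 0, 2], ![6, 2, 4, 0], ![6, 2, 0, 4],
      ![6, 0, 4, 2], ![6, 0, 2, 4], ![4, 6, 2, 0], ![4, 6, 0, 2],
      ![4, 2, 6, 0], ![4, 2, 0, 6], ![4, 0, 6, 2], ![4, 0, 2, 6],
      ![2, 6, 4, 0], ![2, 6, 0, 4], ![2, 4, 6, 0], ![2, 4, 0, 6],
      ![2, 0, 6, 4], ![2, 0, 4, 6], ![0, 6, 4, 2], ![0, 6, 2, 4],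
      ![0, 4, 6, 2], ![0, 4, 2, 6], ![0, 2, 6, 4], ![0, 2, 4, 6]} := by decide +kernel
  rw [sigma4, h]
  repeat rw [Finset.sum_insert (by decide)]
  simp only [Finset.sum_singleton, map_add, map_mul, map_pow, aeval_X, Fin.prod_univ_four,
    Matrix.cons_val, pow_zero, mul_one, one_mul, add_assoc]

theorem aeval_sigma4_6222 (x y z t : A) :
    aeval ![x, y, z, t] (sigma4 ![6, 2, 2, 2]) =
      x ^ 6 * y ^ 2 * z ^ 2 * t ^ 2 + x ^ 2 * y ^ 6 * z ^ 2 * t ^ 2 + x ^ 2 * y ^ 2 * z ^ 6 * t ^ 2 +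
      x ^ 2 * y ^ 2 * z ^ 2 * t ^ 6 := by
  have h : Finset.univ.image (fun σ : Equiv.Perm (Fin 4) => (![6, 2, 2, 2] : Fin 4 → ℕ) ∘ σ) =
      {![6, 2, 2, 2], ![2, 6, 2, 2], ![2, 2, 6, 2], ![2, 2, 2, 6]} := by decide +kernel
  rw [sigma4, h]
  repeat rw [Finset.sum_insert (by decide)]
  simp only [Finset.sum_singleton, map_add, map_mul, map_pow, aeval_X, Fin.prod_univ_four,
    Matrix.cons_val, add_assoc]

theorem aeval_sigma4_4440 (x y z t : A) :
    aeval ![x, y, z, t] (sigma4 ![4, 4, 4, 0]) =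
      x ^ 4 * y ^ 4 * z ^ 4 + x ^ 4 * y ^ 4 * t ^ 4 + x ^ 4 * z ^ 4 * t ^ 4 +
      y ^ 4 * z ^ 4 * t ^ 4 := by
  have h : Finset.univ.image (fun σ : Equiv.Perm (Fin 4) => (![4, 4, 4, 0] : Fin 4 → ℕ) ∘ σ) =
      {![4, 4, 4, 0], ![4, 4, 0, 4], ![4, 0, 4, 4], ![0, 4, 4, 4]} := by decide +kernel
  rw [sigma4, h]
  repeat rw [Finset.sum_insert (by decide)]
  simp only [Finset.sum_singleton, map_add, map_mul, map_pow, aeval_X, Fin.prod_univ_four,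
    Matrix.cons_val, pow_zero, mul_one, one_mul, add_assoc]

theorem aeval_sigma4_4422 (x y z t : A) :
    aeval ![x, y, z, t] (sigma4 ![4, 4, 2, 2]) =
      x ^ 4 * y ^ 4 * z ^ 2 * t ^ 2 + x ^ 4 * y ^ 2 * z ^ 4 * t ^ 2 + x ^ 4 * y ^ 2 * z ^ 2 * t ^ 4 +
      x ^ 2 * y ^ 4 * z ^ 4 * t ^ 2 + x ^ 2 * y ^ 4 * z ^ 2 * t ^ 4 + x ^ 2 * y ^ 2 * z ^ 4 * t ^ 4 := by
  have h : Finset.univ.image (fun σ : Equiv.Perm (Fin 4) => (![4, 4, 2, 2] : Fin 4 → ℕ) ∘ σ) =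
      {![4, 4, 2, 2], ![4, 2, 4, 2], ![4, 2, 2, 4], ![2, 4, 4, 2],
      ![2, 4, 2, 4], ![2, 2, 4, 4]} := by decide +kernel
  rw [sigma4, h]
  repeat rw [Finset.sum_insert (by decide)]
  simp only [Finset.sum_singleton, map_add, map_mul, map_pow, aeval_X, Fin.prod_univ_four,
    Matrix.cons_val, add_assoc]

/-- This form makes invariance under signs and permutations immediate and simplifies the restriction
to `t = 0`, where `e4 = 0` and `e3 = (xyz)²`. The algebra `A` is left general for use with numbers,
with the variables themselves and with polynomial curve germs. -/
theorem aeval_f1 (x y z t : A) :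
    aeval ![x, y, z, t] f1 = e1 x y z t ^ 2 - 8 * e2 x y z t := by
  simp only [f1, map_sub, map_mul, map_ofNat, aeval_sigma4_4000,
    aeval_sigma4_2200, e1, e2]
  ring

theorem aeval_f2 (x y z t : A) :
    aeval ![x, y, z, t] f2 =
      e1 x y z t ^ 4 - 32 * e1 x y z t * e3 x y z t + 256 * e4 x y z t := by
  simp only [f2, map_add, map_sub, map_mul, map_ofNat, aeval_sigma4_8000,
    aeval_sigma4_6200, aeval_sigma4_4400, aeval_sigma4_4220, aeval_sigma4_2222, e1, e3, e4]
  ring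

theorem aeval_f3 (x y z t : A) :
    aeval ![x, y, z, t] f3 =
      e3 x y z t * (e1 x y z t ^ 3 - 4 * e1 x y z t * e2 x y z t + 4 * e3 x y z t) +
        4 * e1 x y z t ^ 2 * e4 x y z t := by
  simp only [f3, map_add, map_sub, map_mul, map_ofNat, aeval_sigma4_8220,
    aeval_sigma4_6420, aeval_sigma4_6222, aeval_sigma4_4440, aeval_sigma4_4422, e1, e2, e3, e4]
  ring

end Formulas

end G29

/-! ### Linear substitutions -/

/-- The substitution `f ↦ f ∘ M` for a matrix `M`. -/
noncomputable def matSubst {n : ℕ} (M : Matrix (Fin n) (Fin n) ℂ) :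
    MvPolynomial (Fin n) ℂ →ₐ[ℂ] MvPolynomial (Fin n) ℂ :=
  aeval fun i => ∑ j, C (M i j) * X j

theorem linSubst_eq_matSubst {n : ℕ} (g : GL (Fin n) ℂ) :
    linSubst g = matSubst (g : Matrix (Fin n) (Fin n) ℂ) := rfl

section MatSubst

variable {n : ℕ} (M N : Matrix (Fin n) (Fin n) ℂ) (p : MvPolynomial (Fin n) ℂ)

theorem aeval_matSubst {A : Type*} [CommRing A] [Algebra ℂ A] (v : Fin n → A) :
    aeval v (matSubst M p) = aeval (fun i => ∑ j, algebraMap ℂ A (M i j) * v j) p := by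
  rw [matSubst, ← AlgHom.comp_apply, comp_aeval]
  simp

theorem eval_matSubst (v : Fin n → ℂ) : eval v (matSubst M p) = eval (M.mulVec v) p := by
  have h := aeval_matSubst M p v
  exact h

theorem matSubst_matSubst : matSubst N (matSubst M p) = matSubst (M * N) p := by
  refine MvPolynomial.funext fun v => ?_
  simp [eval_matSubst]

@[simp]
theorem matSubst_one : matSubst 1 p = p := by
  refine MvPolynomial.funext fun v => ?_
  simp [eval_matSubst]

theorem MvPolynomial.IsHomogeneous.matSubst {p : MvPolynomial (Fin n) ℂ} {d : ℕ}
    (hp : p.IsHomogeneous d) : (matSubst M p).IsHomogeneous d := by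
  have := hp.aeval (n := 1) (fun i => ∑ j, C (M i j) * X j) fun i =>
    IsHomogeneous.sum _ _ _ fun j _ => isHomogeneous_C_mul_X _ _
  rwa [one_mul] at this

variable {M} in
theorem irreducible_matSubst_iff (hM : M * M = 1) :
    Irreducible (matSubst M p) ↔ Irreducible p :=
  MulEquiv.irreducible_iff (AlgEquiv.ofAlgHom (matSubst M) (matSubst M)
    (AlgHom.ext fun q => by simp [matSubst_matSubst, hM])
    (AlgHom.ext fun q => by simp [matSubst_matSubst, hM]))

end MatSubst

theorem mulVec_four (M : Matrix (Fin 4) (Fin 4) ℂ) (x y z t : ℂ) :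
    M.mulVec ![x, y, z, t] = ![M 0 0 * x + M 0 1 * y + M 0 2 * z + M 0 3 * t,
      M 1 0 * x + M 1 1 * y + M 1 2 * z + M 1 3 * t,
      M 2 0 * x + M 2 1 * y + M 2 2 * z + M 2 3 * t,
      M 3 0 * x + M 3 1 * y + M 3 2 * z + M 3 3 * t] := by
  ext i
  fin_cases i <;> simp [Matrix.mulVec, dotProduct, Fin.sum_univ_four]

/-! ### Matrices of the conjugated group -/

namespace G29

noncomputable section

/-- The change of coordinates relating the invariants of the group to `f₁`, `f₂`, `f₃`. -/
def matP : Matrix (Fin 4) (Fin 4) ℂ :=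
  !![1 / 2, -1 / 2, -1 / 2, 1 / 2; -1 / 2, 1 / 2, -1 / 2, 1 / 2;
    -1 / 2, -1 / 2, 1 / 2, 1 / 2; 1 / 2, 1 / 2, 1 / 2, 1 / 2]

/-- The conjugate of `matS3` by `matP`. -/
def matR : Matrix (Fin 4) (Fin 4) ℂ :=
  !![1 / 2, 1 / 2, Complex.I / 2, -Complex.I / 2; 1 / 2, 1 / 2, -Complex.I / 2, Complex.I / 2;
    -Complex.I / 2, Complex.I / 2, 1 / 2, 1 / 2; Complex.I / 2, -Complex.I / 2, 1 / 2, 1 / 2]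

/-- The change of sign of the coordinate `i`. -/
def sgn (i : Fin 4) : Matrix (Fin 4) (Fin 4) ℂ :=
  Matrix.of fun a b => if a = b then (if a = i then -1 else 1) else 0

/-- The exchange of the coordinates `i` and `j`. -/
def swp (i j : Fin 4) : Matrix (Fin 4) (Fin 4) ℂ :=
  Matrix.of fun a b => if Equiv.swap i j a = b then 1 else 0

theorem sgn_mulVec (i : Fin 4) (v : Fin 4 → ℂ) :
    (sgn i).mulVec v = fun a => if a = i then -v a else v a := by
  ext a
  simp only [Matrix.mulVec, dotProduct, sgn, Matrix.of_apply, ite_mul, zero_mul,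
    Finset.sum_ite_eq, Finset.mem_univ, if_true]
  split_ifs <;> ring

theorem swp_mulVec (i j : Fin 4) (v : Fin 4 → ℂ) :
    (swp i j).mulVec v = fun a => v (Equiv.swap i j a) := by
  ext a
  simp [Matrix.mulVec, dotProduct, swp, Matrix.of_apply, ite_mul]

theorem sgn_mul_self (i : Fin 4) : sgn i * sgn i = 1 :=
  Matrix.toLin'.injective <| LinearMap.ext fun v => by
    ext a; simp [Matrix.toLin'_mul, sgn_mulVec]; aesop

theorem swp_mul_self (i j : Fin 4) : swp i j * swp i j = 1 :=
  Matrix.toLin'.injective <| LinearMap.ext fun v => by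
    ext a; simp [Matrix.toLin'_mul, swp_mulVec]

theorem swp_zero_one : swp 0 1 = matS1 := by
  ext i j; fin_cases i <;> fin_cases j <;> simp [swp, matS1, Equiv.swap_apply_def]

theorem swp_one_two : swp 1 2 = matS2 := by
  ext i j; fin_cases i <;> fin_cases j <;> simp [swp, matS2, Equiv.swap_apply_def]

theorem matP_mul_self : matP * matP = 1 := by
  ext i j
  fin_cases i <;> fin_cases j <;>
    simp [matP, Matrix.mul_apply, Fin.sum_univ_four, Matrix.cons_val] <;> norm_num

/-- This and the next three identities compute the conjugates of the generators by the involution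
`matP`: the two transpositions are unchanged, `matS3` becomes `matR`, and `matS4` becomes the sign
change of the last coordinate. -/
theorem matP_mul_matS1 : matP * matS1 = matS1 * matP := by
  ext i j
  fin_cases i <;> fin_cases j <;> simp [matP, matS1, Matrix.mul_apply, Fin.sum_univ_four]

theorem matP_mul_matS2 : matP * matS2 = matS2 * matP := by
  ext i j
  fin_cases i <;> fin_cases j <;> simp [matP, matS2, Matrix.mul_apply, Fin.sum_univ_four]

theorem matP_mul_matS3 : matP * matS3 = matR * matP := by
  ext i j
  fin_cases i <;> fin_cases j <;>
    simp [matP, matS3, matR, Matrix.mul_apply, Fin.sum_univ_four] <;> ring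

theorem matP_mul_matS4 : matP * matS4 = sgn 3 * matP := by
  ext i j
  fin_cases i <;> fin_cases j <;>
    simp [matP, matS4, sgn, Matrix.mul_apply, Fin.sum_univ_four, Matrix.cons_val] <;> norm_num

theorem matR_eq : matR = matP * matS3 * matP := by
  rw [matP_mul_matS3, mul_assoc, matP_mul_self, mul_one]

theorem matR_mul_self : matR * matR = 1 := by
  rw [matR_eq]
  calc _ = matP * matS3 * (matP * matP) * matS3 * matP := by simp only [mul_assoc]
    _ = matP * (matS3 * matS3) * matP := by rw [matP_mul_self]; simp only [mul_assoc, mul_one]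
    _ = 1 := by rw [matS3_mul_self, mul_one, matP_mul_self]

theorem matR_mul_sgn : matR * sgn 3 =
    !![1 / 2, 1 / 2, Complex.I / 2, Complex.I / 2; 1 / 2, 1 / 2, -Complex.I / 2, -Complex.I / 2;
      -Complex.I / 2, Complex.I / 2, 1 / 2, -1 / 2;
      Complex.I / 2, -Complex.I / 2, 1 / 2, -1 / 2] := by
  ext i j
  fin_cases i <;> fin_cases j <;>
    simp [matR, sgn, Matrix.mul_apply, Matrix.cons_val] <;> ring

theorem sgn_mul_matR : sgn 3 * matR =
    !![1 / 2, 1 / 2, Complex.I / 2, -Complex.I / 2; 1 / 2, 1 / 2, -Complex.I / 2, Complex.I / 2;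
      -Complex.I / 2, Complex.I / 2, 1 / 2, 1 / 2;
      -Complex.I / 2, Complex.I / 2, -1 / 2, -1 / 2] := by
  ext i j
  fin_cases i <;> fin_cases j <;>
    simp [matR, sgn, Matrix.mul_apply, Matrix.cons_val] <;> ring

/-- For involutions, a braid relation `ABA = BAB` makes `A` and `B` conjugate. The chain `sgn 3`,
`matR`, `matS2`, `matS1` of such relations carries a property of one reflection to all generators.
-/
theorem matR_braid_sgn : matR * sgn 3 * matR = sgn 3 * matR * sgn 3 := by
  rw [matR_mul_sgn, sgn_mul_matR]
  ext i j
  fin_cases i <;> fin_cases j <;>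
    simp [matR, sgn, Matrix.mul_apply, Fin.sum_univ_four, Matrix.cons_val] <;>
    linear_combination (norm := ring_nf) <;>
    simp [Complex.I_sq]

theorem matR_eq_conj : matR = sgn 3 * (matR * sgn 3 * matR) * sgn 3 := by
  rw [matR_braid_sgn]
  calc matR = (sgn 3 * sgn 3) * matR * (sgn 3 * sgn 3) := by
        rw [sgn_mul_self, one_mul, mul_one]
    _ = _ := by simp only [mul_assoc]

theorem matS3_braid_matS2 : matS2 * matS3 * matS2 = matS3 * matS2 * matS3 := by
  ext i j
  fin_cases i <;> fin_cases j <;>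
    simp [matS3, matS2, Matrix.mul_apply, Fin.sum_univ_four, Matrix.cons_val]

theorem matS2_braid_matR : matS2 * matR * matS2 = matR * matS2 * matR := by
  have h : matS2 = matP * matS2 * matP := by
    rw [matP_mul_matS2, mul_assoc, matP_mul_self, mul_one]
  have e : ∀ A B : Matrix (Fin 4) (Fin 4) ℂ,
      (matP * A * matP) * (matP * B * matP) * (matP * A * matP) = matP * (A * B * A) * matP := by
    intro A B
    calc _ = matP * A * (matP * matP) * B * (matP * matP) * A * matP := by simp only [mul_assoc]
      _ = _ := by rw [matP_mul_self]; simp only [mul_assoc, mul_one]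
  rw [h, matR_eq, e, e, matS3_braid_matS2]

theorem matS2_eq_conj : matS2 = matR * (matS2 * matR * matS2) * matR := by
  rw [matS2_braid_matR]
  calc matS2 = (matR * matR) * matS2 * (matR * matR) := by
        rw [matR_mul_self, one_mul, mul_one]
    _ = _ := by simp only [mul_assoc]

theorem matS1_eq_conj : matS1 = matS2 * (matS1 * matS2 * matS1) * matS2 := by
  ext i j
  fin_cases i <;> fin_cases j <;>
    simp [matS1, matS2, Matrix.mul_apply, Fin.sum_univ_four, Matrix.cons_val]

end

end G29

/-! ### Invariance of the three forms -/

namespace G29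

theorem eval_four {p q : MvPolynomial (Fin 4) ℂ}
    (h : ∀ x y z t : ℂ, eval ![x, y, z, t] p = eval ![x, y, z, t] q) : p = q := by
  refine MvPolynomial.funext fun v => ?_
  have : v = ![v 0, v 1, v 2, v 3] := by ext i; fin_cases i <;> rfl
  rw [this]
  exact h _ _ _ _

theorem eval_f1 (x y z t : ℂ) : eval ![x, y, z, t] f1 = e1 x y z t ^ 2 - 8 * e2 x y z t :=
  aeval_f1 x y z t

theorem eval_f2 (x y z t : ℂ) : eval ![x, y, z, t] f2 =
    e1 x y z t ^ 4 - 32 * e1 x y z t * e3 x y z t + 256 * e4 x y z t :=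
  aeval_f2 x y z t

theorem eval_f3 (x y z t : ℂ) : eval ![x, y, z, t] f3 =
    e3 x y z t * (e1 x y z t ^ 3 - 4 * e1 x y z t * e2 x y z t + 4 * e3 x y z t) +
      4 * e1 x y z t ^ 2 * e4 x y z t :=
  aeval_f3 x y z t

theorem aeval_dodecic {A : Type*} [CommRing A] [Algebra ℂ A] (l m : ℂ) (v : Fin 4 → A) :
    aeval v (dodecic l m) = aeval v f3 + algebraMap ℂ A l * (aeval v f2 * aeval v f1) +
      algebraMap ℂ A m * aeval v f1 ^ 3 := by
  simp [dodecic]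

theorem eval_dodecic (l m : ℂ) (v : Fin 4 → ℂ) :
    eval v (dodecic l m) = eval v f3 + l * (eval v f2 * eval v f1) + m * eval v f1 ^ 3 :=
  aeval_dodecic l m v

/-- The elementary symmetric polynomial of degree `1` in the fourth powers of four numbers. -/
def E1 (x y z t : ℂ) : ℂ := x ^ 4 + y ^ 4 + z ^ 4 + t ^ 4

/-- The elementary symmetric polynomial of degree `2` in the fourth powers of four numbers. -/
def E2 (x y z t : ℂ) : ℂ :=
  (x * y) ^ 4 + (x * z) ^ 4 + (x * t) ^ 4 + (y * z) ^ 4 + (y * t) ^ 4 + (z * t) ^ 4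

/-- The elementary symmetric polynomial of degree `3` in the fourth powers of four numbers. -/
def E3 (x y z t : ℂ) : ℂ :=
  (x * y * z) ^ 4 + (x * y * t) ^ 4 + (x * z * t) ^ 4 + (y * z * t) ^ 4

/-- The three quantities `f₁`, `f₂`, `f₃` are unchanged under substitution of `M`. -/
structure Fixes (M : Matrix (Fin 4) (Fin 4) ℂ) : Prop where
  f1 : matSubst M f1 = f1
  f2 : matSubst M f2 = f2
  f3 : matSubst M f3 = f3

theorem Fixes.dodecic {M : Matrix (Fin 4) (Fin 4) ℂ} (h : Fixes M) (l m : ℂ) :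
    matSubst M (dodecic l m) = dodecic l m := by
  simp only [G29.dodecic, map_add, map_mul, map_pow, algHom_C, h.f1, h.f2, h.f3]
  rfl

theorem matP_mulVec (x y z t : ℂ) : matP.mulVec ![x, y, z, t] =
    ![(x - y - z + t) / 2, (-x + y - z + t) / 2, (-x - y + z + t) / 2, (x + y + z + t) / 2] := by
  rw [mulVec_four]
  ext i
  fin_cases i <;> simp [matP] <;> ring

/-- In the original coordinates the forms depend only on `E1`, `E2`, `E3` and `xyzt`, all of which
`matS3` preserves; `fixes_matR` rests on this. -/
theorem eval_matP_f1 (x y z t : ℂ) : eval ![x, y, z, t] (matSubst matP f1) =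
    -2 * (E1 x y z t - 12 * (x * y * z * t)) := by
  rw [eval_matSubst, matP_mulVec, eval_f1]
  simp only [e1, e2, E1]
  ring

theorem eval_matP_f2 (x y z t : ℂ) : eval ![x, y, z, t] (matSubst matP f2) =
    16 * E2 x y z t + 32 * (x * y * z * t) * E1 x y z t + 32 * (x * y * z * t) ^ 2 := by
  rw [eval_matSubst, matP_mulVec, eval_f2]
  simp only [e1, e3, e4, E1, E2]
  ring

theorem eval_matP_f3 (x y z t : ℂ) : eval ![x, y, z, t] (matSubst matP f3) =
    (x * y * z * t) * E1 x y z t ^ 2 - 4 * (x * y * z * t) * E2 x y z t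
      - 4 * (x * y * z * t) ^ 2 * E1 x y z t + 4 * E3 x y z t + 8 * (x * y * z * t) ^ 3 := by
  rw [eval_matSubst, matP_mulVec, eval_f3]
  simp only [e1, e2, e3, e4, E1, E2, E3]
  ring

theorem fixes_of_e {M : Matrix (Fin 4) (Fin 4) ℂ} (h : ∀ x y z t : ℂ, ∃ x' y' z' t' : ℂ,
    M.mulVec ![x, y, z, t] = ![x', y', z', t'] ∧ e1 x' y' z' t' = e1 x y z t ∧
    e2 x' y' z' t' = e2 x y z t ∧ e3 x' y' z' t' = e3 x y z t ∧ e4 x' y' z' t' = e4 x y z t) :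
    Fixes M := by
  constructor <;> refine eval_four fun x y z t => ?_ <;>
  obtain ⟨x', y', z', t', hM, h1, h2, h3, h4⟩ := h x y z t <;>
  rw [eval_matSubst, hM]
  · rw [eval_f1, eval_f1, h1, h2]
  · rw [eval_f2, eval_f2, h1, h3, h4]
  · rw [eval_f3, eval_f3, h1, h2, h3, h4]

theorem fixes_sgn (i : Fin 4) : Fixes (sgn i) := by
  refine fixes_of_e fun x y z t => ⟨if i = 0 then -x else x, if i = 1 then -y else y,
    if i = 2 then -z else z, if i = 3 then -t else t, ?_, ?_, ?_, ?_, ?_⟩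
  · rw [sgn_mulVec]
    ext a
    fin_cases a <;> simp [eq_comm]
  all_goals
    fin_cases i <;> simp [e1, e2, e3, e4]

theorem swp_mulVec_four (i j : Fin 4) (v : Fin 4 → ℂ) : (swp i j).mulVec v =
    ![v (Equiv.swap i j 0), v (Equiv.swap i j 1), v (Equiv.swap i j 2), v (Equiv.swap i j 3)] := by
  rw [swp_mulVec]
  ext a
  fin_cases a <;> rfl

theorem fixes_swp (i j : Fin 4) : Fixes (swp i j) := by
  refine fixes_of_e fun x y z t => ⟨_, _, _, _, swp_mulVec_four i j _, ?_, ?_, ?_, ?_⟩ <;>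
  fin_cases i <;> fin_cases j <;>
  simp [e1, e2, e3, e4, Equiv.swap_apply_def] <;> ring

theorem matSubst_matP_matP (p : MvPolynomial (Fin 4) ℂ) :
    matSubst matP (matSubst matP p) = p := by
  rw [matSubst_matSubst, matP_mul_self, matSubst_one]

theorem matS3_mulVec (x y z t : ℂ) :
    matS3.mulVec ![x, y, z, t] = ![-Complex.I * y, Complex.I * x, z, t] := by
  rw [mulVec_four]
  ext i
  fin_cases i <;> simp [matS3]

theorem fixes_matR : Fixes matR := by
  have key : ∀ x y z t : ℂ, E1 (-Complex.I * y) (Complex.I * x) z t = E1 x y z t ∧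
      E2 (-Complex.I * y) (Complex.I * x) z t = E2 x y z t ∧
      E3 (-Complex.I * y) (Complex.I * x) z t = E3 x y z t ∧
      (-Complex.I * y) * (Complex.I * x) * z * t = x * y * z * t := by
    intro x y z t
    have hI : Complex.I ^ 4 = 1 := Complex.I_pow_four
    have hI2 : Complex.I ^ 2 = -1 := Complex.I_sq
    have ha : (-Complex.I * y) ^ 4 = y ^ 4 := by linear_combination y ^ 4 * hI
    have hb : (Complex.I * x) ^ 4 = x ^ 4 := by linear_combination x ^ 4 * hI
    simp only [E1, E2, E3, mul_pow _ _ 4] at ha hb ⊢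
    simp only [ha, hb]
    refine ⟨by ring, by ring, by ring, ?_⟩
    linear_combination (-x * y * z * t) * hI2
  have main : ∀ f : MvPolynomial (Fin 4) ℂ,
      matSubst matS3 (matSubst matP f) = matSubst matP f → matSubst matR f = f := by
    intro f hf
    -- `matR` is the conjugate of `matS3` by `matP`, so invariance of the transform under `matS3`
    -- suffices.
    rw [matR_eq, ← matSubst_matSubst, ← matSubst_matSubst, hf, matSubst_matP_matP]
  constructor <;> refine main _ (eval_four fun x y z t => ?_) <;>
  obtain ⟨h1, h2, h3, h4⟩ := key x y z t <;>
  rw [eval_matSubst, matS3_mulVec]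
  · rw [eval_matP_f1, eval_matP_f1, h1, h4]
  · rw [eval_matP_f2, eval_matP_f2, h1, h2, h4]
  · rw [eval_matP_f3, eval_matP_f3, h1, h2, h3, h4]

/-- The transforms of `f₁`, `f₂`, `f₃` by `matP` are invariants of the group. -/
theorem mem_polyInvariants_of_fixes {f : MvPolynomial (Fin 4) ℂ} (h1 : matSubst matS1 f = f)
    (h2 : matSubst matS2 f = f) (h3 : matSubst matR f = f) (h4 : matSubst (sgn 3) f = f) :
    matSubst matP f ∈ polyInvariants group := by
  rw [mem_polyInvariants]
  intro g hg
  induction hg using Subgroup.closure_induction with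
  | mem g hg =>
    have e : ∀ A B : Matrix (Fin 4) (Fin 4) ℂ, matP * A = B * matP → matSubst B f = f →
        matSubst A (matSubst matP f) = matSubst matP f := by
      intro A B hAB hB
      rw [matSubst_matSubst, hAB, ← matSubst_matSubst, hB]
    rw [linSubst_eq_matSubst]
    rcases hg with rfl | rfl | rfl | rfl
    · exact e _ _ matP_mul_matS1 h1
    · exact e _ _ matP_mul_matS2 h2
    · exact e _ _ matP_mul_matS3 h3
    · exact e _ _ matP_mul_matS4 h4
  | one => rw [linSubst_eq_matSubst, Units.val_one, matSubst_one]
  | mul g h _ _ hg hh =>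
    rw [linSubst_eq_matSubst] at hg hh ⊢
    rw [Units.val_mul, ← matSubst_matSubst, hg, hh]
  | inv g _ hg =>
    rw [linSubst_eq_matSubst] at hg ⊢
    conv_lhs => rw [← hg]
    rw [matSubst_matSubst, Units.mul_inv, matSubst_one]

theorem matP_f1_mem : matSubst matP f1 ∈ polyInvariants group :=
  mem_polyInvariants_of_fixes (swp_zero_one ▸ (fixes_swp 0 1).f1)
    (swp_one_two ▸ (fixes_swp 1 2).f1) fixes_matR.f1 (fixes_sgn 3).f1

theorem matP_f2_mem : matSubst matP f2 ∈ polyInvariants group :=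
  mem_polyInvariants_of_fixes (swp_zero_one ▸ (fixes_swp 0 1).f2)
    (swp_one_two ▸ (fixes_swp 1 2).f2) fixes_matR.f2 (fixes_sgn 3).f2

end G29

/-! ### Test points off the dodecics -/

namespace G29

variable {l m : ℂ} {p : MvPolynomial (Fin 4) ℂ}

theorem sgn_zero_mulVec (x y z t : ℂ) : (sgn 0).mulVec ![x, y, z, t] = ![-x, y, z, t] := by
  rw [mulVec_four]; ext i; fin_cases i <;> simp [sgn]

theorem sgn_three_mulVec (x y z t : ℂ) : (sgn 3).mulVec ![x, y, z, t] = ![x, y, z, -t] := by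
  rw [mulVec_four]; ext i; fin_cases i <;> simp [sgn]

/-- On `f1 = 0` the parameters `l` and `m` disappear, so test points chosen on this quartic serve
for all dodecics at once. -/
theorem eval_f3_eq_zero_of_dvd (hp : p ∣ dodecic l m) {v : Fin 4 → ℂ}
    (h1 : eval v f1 = 0) (hv : eval v p = 0) : eval v f3 = 0 := by
  obtain ⟨q, hq⟩ := hp
  have := congrArg (eval v) hq
  rw [eval_dodecic, h1, map_mul, hv] at this
  simpa using this

theorem exists_cube_root : ∃ w : ℂ, w ^ 2 + w + 1 = 0 := by
  obtain ⟨s, hs⟩ := IsAlgClosed.exists_pow_nat_eq (-3 : ℂ) (n := 2) (by norm_num)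
  exact ⟨(-1 + s) / 2, by linear_combination hs / 4⟩

/-- The squares of the first three coordinates are the three cube roots of unity, with `e1 = e2 = 0`
and `e3 = 1`. Thus `f1 = 0` and `f3 = 4` at this point. -/
theorem e_values_cube_root {w : ℂ} (hw : w ^ 2 + w + 1 = 0) :
    (e1 1 w (w ^ 2) 0 ^ 2 - 8 * e2 1 w (w ^ 2) 0 = 0) ∧
      e3 1 w (w ^ 2) 0 * (e1 1 w (w ^ 2) 0 ^ 3 - 4 * e1 1 w (w ^ 2) 0 * e2 1 w (w ^ 2) 0
        + 4 * e3 1 w (w ^ 2) 0) + 4 * e1 1 w (w ^ 2) 0 ^ 2 * e4 1 w (w ^ 2) 0 = 4 := by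
  have h1 : e1 1 w (w ^ 2) 0 = 0 := by
    simp only [e1]; linear_combination (w ^ 2 - w + 1) * hw
  have h2 : e2 1 w (w ^ 2) 0 = 0 := by
    simp only [e2]; linear_combination (w ^ 4 - w ^ 3 + w ^ 2) * hw
  have h3 : e3 1 w (w ^ 2) 0 = 1 := by
    simp only [e3]; linear_combination (w - 1) * (w ^ 3 + 1) * hw
  rw [h1, h2, h3]
  norm_num

theorem eval_ne_zero_of_dvd_last (hp : p ∣ dodecic l m) {w : ℂ} (hw : w ^ 2 + w + 1 = 0) :
    eval ![1, w, w ^ 2, 0] p ≠ 0 := by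
  intro h
  obtain ⟨h1, h3⟩ := e_values_cube_root hw
  have := eval_f3_eq_zero_of_dvd hp ((eval_f1 _ _ _ _).trans h1) h
  rw [eval_f3, h3] at this
  norm_num at this

theorem eval_ne_zero_of_dvd_first (hp : p ∣ dodecic l m) {w : ℂ} (hw : w ^ 2 + w + 1 = 0) :
    eval ![0, 1, w, w ^ 2] p ≠ 0 := by
  intro h
  obtain ⟨h1, h3⟩ := e_values_cube_root hw
  have k1 : e1 0 1 w (w ^ 2) = e1 1 w (w ^ 2) 0 := by simp only [e1]; ring
  have k2 : e2 0 1 w (w ^ 2) = e2 1 w (w ^ 2) 0 := by simp only [e2]; ring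
  have k3 : e3 0 1 w (w ^ 2) = e3 1 w (w ^ 2) 0 := by simp only [e3]; ring
  have k4 : e4 0 1 w (w ^ 2) = e4 1 w (w ^ 2) 0 := by simp only [e4]; ring
  have := eval_f3_eq_zero_of_dvd hp ((eval_f1 _ _ _ _).trans (by rw [k1, k2]; exact h1)) h
  rw [eval_f3, k1, k2, k3, k4, h3] at this
  norm_num at this

/-- A point of the mirrors `x = ± t` on the quartic `f₁ = 0` and not on the dodecics. -/
theorem exists_eval_ne_zero_mirror (hp : p ∣ dodecic l m) (c : ℂ) (hc : c ^ 2 = 1) :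
    ∃ y : ℂ, eval ![1, y, 0, c] p ≠ 0 := by
  -- With `u = y²`, the equation `f1 = 0` at `(1, y, 0, c)` reads `u² - 12u - 4 = 0`, with root `6 +
  -- √40`.
  obtain ⟨s, hs⟩ := IsAlgClosed.exists_pow_nat_eq (40 : ℂ) (n := 2) (by norm_num)
  obtain ⟨y, hy⟩ := IsAlgClosed.exists_pow_nat_eq (6 + s) (n := 2) (by norm_num)
  refine ⟨y, fun h => ?_⟩
  have k1 : e1 1 y 0 c = 2 + (6 + s) := by simp only [e1]; linear_combination hc + hy
  have k2 : e2 1 y 0 c = 1 + 2 * (6 + s) := by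
    simp only [e2]; linear_combination (1 + c ^ 2) * hy + (7 + s) * hc
  have k3 : e3 1 y 0 c = 6 + s := by
    simp only [e3]; linear_combination c ^ 2 * hy + (6 + s) * hc
  have k4 : e4 1 y 0 c = 0 := by simp only [e4]; ring
  have := eval_f3_eq_zero_of_dvd hp ((eval_f1 _ _ _ _).trans
    (by rw [k1, k2]; linear_combination hs)) h
  rw [eval_f3, k1, k2, k3, k4] at this
  -- Vanishing of `f3` would make `√40` rational, equal to `-234/37`; but `234² = 54756` and `37² *
  -- 40 = 54760`.
  have hs6 : s * 37 = -234 := by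
    linear_combination this / 40 - (s ^ 2 / 40 + 11 / 20 * s + 27 / 5) * hs
  have : (54756 : ℂ) = 54760 := by
    linear_combination (-(s * 37) + 234) * hs6 + 1369 * hs
  norm_num at this

/-- A point of the planes `x = - c * t` with `c ^ 2 = -1` on the quartic and not on the dodecics. -/
theorem exists_eval_ne_zero_plane (hp : p ∣ dodecic l m) (c : ℂ) (hc : c ^ 2 = -1) :
    ∃ y : ℂ, eval ![-c, y, 0, 1] p ≠ 0 := by
  -- Here `f1 = 0` reads `u² = -8` for `u = y²`, and then `f3 = -u⁴ = -64`.
  obtain ⟨s, hs⟩ := IsAlgClosed.exists_pow_nat_eq (-8 : ℂ) (n := 2) (by norm_num)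
  obtain ⟨y, hy⟩ := IsAlgClosed.exists_pow_nat_eq s (n := 2) (by norm_num)
  refine ⟨y, fun h => ?_⟩
  have k1 : e1 (-c) y 0 1 = s := by simp only [e1]; linear_combination hc + hy
  have k2 : e2 (-c) y 0 1 = -1 := by
    simp only [e2]; linear_combination (1 + c ^ 2) * hy + (1 + s) * hc
  have k3 : e3 (-c) y 0 1 = -s := by
    simp only [e3]; linear_combination c ^ 2 * hy + s * hc
  have k4 : e4 (-c) y 0 1 = 0 := by simp only [e4]; ring
  have := eval_f3_eq_zero_of_dvd hp ((eval_f1 _ _ _ _).trans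
    (by rw [k1, k2]; linear_combination hs)) h
  rw [eval_f3, k1, k2, k3, k4] at this
  have : (64 : ℂ) = 0 := by linear_combination -this - (s ^ 2 - 8) * hs
  norm_num at this

section Factors

theorem exists_eq_mul_mul {q F : MvPolynomial (Fin 4) ℂ} (hp : Irreducible p) (hq : Irreducible q)
    (hpF : p ∣ F) (hqF : q ∣ F) (hpq : ¬ Associated p q) : ∃ s, F = p * q * s := by
  obtain ⟨a, rfl⟩ := hpF
  rcases hq.prime.dvd_or_dvd hqF with h | ⟨s, rfl⟩
  · exact absurd (hq.associated_of_dvd hp h).symm hpq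
  · exact ⟨s, by ring⟩

theorem exists_eq_mul_mul_mul {q r F : MvPolynomial (Fin 4) ℂ} (hp : Irreducible p)
    (hq : Irreducible q) (hr : Irreducible r) (hpF : p ∣ F) (hqF : q ∣ F) (hrF : r ∣ F)
    (hpq : ¬ Associated p q) (hpr : ¬ Associated p r) (hqr : ¬ Associated q r) :
    ∃ s, F = p * q * r * s := by
  obtain ⟨a, rfl⟩ := exists_eq_mul_mul hp hq hpF hqF hpq
  rcases hr.prime.dvd_or_dvd hrF with h | ⟨s, rfl⟩
  · rcases hr.prime.dvd_or_dvd h with h | h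
    · exact absurd (hr.associated_of_dvd hp h).symm hpr
    · exact absurd (hr.associated_of_dvd hq h).symm hqr
  · exact ⟨s, by ring⟩

end Factors

/-! ### Transversality away from the coordinate axes -/

section SimplePoints

theorem f1_eq : f1 = e1 (X 0) (X 1) (X 2) (X 3) ^ 2 - 8 * e2 (X 0) (X 1) (X 2) (X 3) := by
  have := aeval_f1 (X 0 : MvPolynomial (Fin 4) ℂ) (X 1) (X 2) (X 3)
  rwa [show (![X 0, X 1, X 2, X 3] : Fin 4 → MvPolynomial (Fin 4) ℂ) = X by
    ext1 i; fin_cases i <;> rfl, aeval_X_left, AlgHom.id_apply] at this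

theorem f3_eq : f3 = e3 (X 0) (X 1) (X 2) (X 3) * (e1 (X 0) (X 1) (X 2) (X 3) ^ 3
    - 4 * e1 (X 0) (X 1) (X 2) (X 3) * e2 (X 0) (X 1) (X 2) (X 3)
    + 4 * e3 (X 0) (X 1) (X 2) (X 3)) +
    4 * e1 (X 0) (X 1) (X 2) (X 3) ^ 2 * e4 (X 0) (X 1) (X 2) (X 3) := by
  have := aeval_f3 (X 0 : MvPolynomial (Fin 4) ℂ) (X 1) (X 2) (X 3)
  rwa [show (![X 0, X 1, X 2, X 3] : Fin 4 → MvPolynomial (Fin 4) ℂ) = X by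
    ext1 i; fin_cases i <;> rfl, aeval_X_left, AlgHom.id_apply] at this

theorem pderiv_four_eq_zero (i : Fin 4) : pderiv i (4 : MvPolynomial (Fin 4) ℂ) = 0 := by
  rw [← map_ofNat (C : ℂ →+* MvPolynomial (Fin 4) ℂ) 4]
  exact pderiv_C

theorem pderiv_eight_eq_zero (i : Fin 4) : pderiv i (8 : MvPolynomial (Fin 4) ℂ) = 0 := by
  rw [← map_ofNat (C : ℂ →+* MvPolynomial (Fin 4) ℂ) 8]
  exact pderiv_C

theorem pderiv_f1 (x y z : ℂ) :
    eval ![x, y, z, 0] (pderiv 0 f1) = 2 * x * (8 * x ^ 2 - 6 * (x ^ 2 + y ^ 2 + z ^ 2)) ∧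
    eval ![x, y, z, 0] (pderiv 1 f1) = 2 * y * (8 * y ^ 2 - 6 * (x ^ 2 + y ^ 2 + z ^ 2)) ∧
    eval ![x, y, z, 0] (pderiv 2 f1) = 2 * z * (8 * z ^ 2 - 6 * (x ^ 2 + y ^ 2 + z ^ 2)) := by
  refine ⟨?_, ?_, ?_⟩ <;> rw [f1_eq] <;>
  simp [e1, e2, Derivation.leibniz, Derivation.leibniz_pow, pderiv_X,
    Matrix.cons_val, pderiv_eight_eq_zero] <;> ring

/-- The factor `K` of `f₃` on the plane `t = 0`, in terms of the squares of the coordinates. -/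
def cubicK (a b c : ℂ) : ℂ :=
  (a + b + c) ^ 3 - 4 * (a + b + c) * (a * b + a * c + b * c) + 4 * (a * b * c)

/-- The derivative of `cubicK` with respect to its first argument. -/
def dcubicK (a b c : ℂ) : ℂ :=
  3 * (a + b + c) ^ 2 - 4 * (a * b + a * c + b * c) - 4 * (a + b + c) * (b + c) + 4 * (b * c)

theorem pderiv_f3 (x y z : ℂ) :
    eval ![x, y, z, 0] (pderiv 0 f3) = 2 * x * (y ^ 2 * z ^ 2 * cubicK (x ^ 2) (y ^ 2) (z ^ 2) +
      x ^ 2 * y ^ 2 * z ^ 2 * dcubicK (x ^ 2) (y ^ 2) (z ^ 2)) ∧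
    eval ![x, y, z, 0] (pderiv 1 f3) = 2 * y * (x ^ 2 * z ^ 2 * cubicK (x ^ 2) (y ^ 2) (z ^ 2) +
      x ^ 2 * y ^ 2 * z ^ 2 * dcubicK (y ^ 2) (x ^ 2) (z ^ 2)) ∧
    eval ![x, y, z, 0] (pderiv 2 f3) = 2 * z * (x ^ 2 * y ^ 2 * cubicK (x ^ 2) (y ^ 2) (z ^ 2) +
      x ^ 2 * y ^ 2 * z ^ 2 * dcubicK (z ^ 2) (x ^ 2) (y ^ 2)) := by
  refine ⟨?_, ?_, ?_⟩ <;> rw [f3_eq] <;>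
  simp [e1, e2, e3, e4, cubicK, dcubicK, Derivation.leibniz, Derivation.leibniz_pow, pderiv_X,
    Matrix.cons_val, pderiv_four_eq_zero] <;> ring

/-- Eliminating between the two equations when two of the squares coincide leaves only `a = b = 0`.
Hence the squares are pairwise distinct at the points of interest, and differences can be cancelled
in `transverse_aux`. -/
theorem conic_cubicK_ne {a b : ℂ} (ha : a ≠ 0) (h1 : (a + a + b) ^ 2 - 8 * (a * a + a * b + a * b) = 0)
    (h2 : cubicK a a b = 0) : False := by
  rw [cubicK] at h2
  have k : a * (a ^ 2 + 3 * a * b + b ^ 2) = 0 := by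
    linear_combination h2 / 8 - (a + a + b) / 8 * h1
  have k1 : a ^ 2 + 3 * a * b + b ^ 2 = 0 := by simpa [ha] using k
  have k2 : a * (a + 3 * b) = 0 := by linear_combination (k1 - h1) / 5
  have k3 : a = -3 * b := by linear_combination (by simpa [ha] using k2 : a + 3 * b = 0)
  have k4 : b ^ 2 = 0 := by rw [k3] at h1; linear_combination h1
  have hb : b = 0 := by simpa using k4
  exact ha (by rw [k3, hb, mul_zero])

/-- The plane quartic `f₁ = 0` is transverse to the curve `K = 0` off the coordinate axes. -/
theorem transverse_aux {a b c k : ℂ} (ha : a ≠ 0) (hb : b ≠ 0) (hc : c ≠ 0)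
    (h1 : (a + b + c) ^ 2 - 8 * (a * b + a * c + b * c) = 0) (h2 : cubicK a b c = 0)
    (da : a * b * c * dcubicK a b c + k * (8 * a - 6 * (a + b + c)) = 0)
    (db : a * b * c * dcubicK b a c + k * (8 * b - 6 * (a + b + c)) = 0)
    (dc : a * b * c * dcubicK c a b + k * (8 * c - 6 * (a + b + c)) = 0) : False := by
  have hab : a - b ≠ 0 := by
    intro h
    obtain rfl : a = b := sub_eq_zero.1 h
    exact conic_cubicK_ne ha h1 h2
  have hac : a - c ≠ 0 := by
    intro h
    obtain rfl : a = c := sub_eq_zero.1 h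
    exact conic_cubicK_ne (b := b) ha (by linear_combination h1)
      (by rw [cubicK] at h2 ⊢; linear_combination h2)
  have hbc : b - c ≠ 0 := by
    intro h
    obtain rfl : b = c := sub_eq_zero.1 h
    exact conic_cubicK_ne (b := a) hb (by linear_combination h1)
      (by rw [cubicK] at h2 ⊢; linear_combination h2)
  simp only [dcubicK] at da db dc
  -- The hypotheses are Lagrange conditions with multiplier `k`. After multiplying each by its own
  -- variable, the difference of two is divisible by the difference of the variables; `qab`, `qac`
  -- and then `q` are successive divided differences.
  have qab : a * b * c * (4 * (a + b + c) * (a + b) - ((a + b + c) ^ 2 + 4 * (a * b + a * c + b * c)))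
      + k * (8 * (a + b) - 6 * (a + b + c)) = 0 := by
    refine (mul_eq_zero.1 (?_ : (a - b) * _ = 0)).resolve_left hab
    linear_combination a * da - b * db
  have qac : a * b * c * (4 * (a + b + c) * (a + c) - ((a + b + c) ^ 2 + 4 * (a * b + a * c + b * c)))
      + k * (8 * (a + c) - 6 * (a + b + c)) = 0 := by
    refine (mul_eq_zero.1 (?_ : (a - c) * _ = 0)).resolve_left hac
    linear_combination a * da - c * dc
  have q : a * b * c * (4 * (a + b + c)) + 8 * k = 0 := by
    refine (mul_eq_zero.1 (?_ : (b - c) * _ = 0)).resolve_left hbc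
    linear_combination qab - qac
  -- This combination eliminates `k` and leaves only the square of `abc`.
  have : (a * b * c) * (a * b * c) = 0 := by
    linear_combination (a * da - a * qab + a * b * q) / 4
  simp [ha, hb, hc] at this

/-- At a zero of `p` in the plane `t = 0` the image of `p` under `t ↦ -t` vanishes too, so the
dodecic is singular there. On `f1 = 0` the gradient condition reads `∇f3 + l f2 ∇f1 = 0`, a tangency
of `K = 0` with the quartic when `xyz ≠ 0`. -/
theorem mul_mul_eq_zero_of_moved {p : MvPolynomial (Fin 4) ℂ} (hp : Irreducible p)
    (hpF : p ∣ dodecic l m) (hmov : ¬ Associated p (matSubst (sgn 3) p)) {x y z : ℂ}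
    (h1 : eval ![x, y, z, 0] f1 = 0) (h : eval ![x, y, z, 0] p = 0) : x * y * z = 0 := by
  by_contra hne
  have hx : x ≠ 0 := by rintro rfl; simp at hne
  have hy : y ≠ 0 := by rintro rfl; simp at hne
  have hz : z ≠ 0 := by rintro rfl; simp at hne
  obtain ⟨s, hs⟩ := exists_eq_mul_mul hp ((irreducible_matSubst_iff p (sgn_mul_self 3)).2 hp) hpF
    (by simpa only [(fixes_sgn 3).dodecic] using map_dvd (matSubst (sgn 3)) hpF) hmov
  have h' : eval ![x, y, z, 0] (matSubst (sgn 3) p) = 0 := by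
    rw [eval_matSubst, sgn_three_mulVec, neg_zero, h]
  have h3 := eval_f3_eq_zero_of_dvd hpF h1 h
  have hd : ∀ i, eval ![x, y, z, 0] (pderiv i f3) +
      (l * eval ![x, y, z, 0] f2) * eval ![x, y, z, 0] (pderiv i f1) = 0 := by
    intro i
    have := congrArg (fun q => eval ![x, y, z, 0] (pderiv i q)) hs
    simpa [dodecic, Derivation.leibniz, Derivation.leibniz_pow, h1, h, h', mul_assoc] using this
  have h0 := hd 0
  have h1' := hd 1
  have h2 := hd 2
  rw [(pderiv_f1 x y z).1, (pderiv_f3 x y z).1] at h0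
  rw [(pderiv_f1 x y z).2.1, (pderiv_f3 x y z).2.1] at h1'
  rw [(pderiv_f1 x y z).2.2, (pderiv_f3 x y z).2.2] at h2
  rw [eval_f1] at h1
  rw [eval_f3] at h3
  simp only [e1, e2, e3, e4] at h1 h3
  -- In the plane `t = 0`, `f3 = (xyz)² K`.
  have hK : cubicK (x ^ 2) (y ^ 2) (z ^ 2) = 0 := by
    have : (x * y * z) ^ 2 * cubicK (x ^ 2) (y ^ 2) (z ^ 2) = 0 := by
      rw [cubicK]; linear_combination h3
    exact (mul_eq_zero.1 this).resolve_left (pow_ne_zero 2 hne)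
  rw [hK] at h0 h1' h2
  refine transverse_aux (a := x ^ 2) (b := y ^ 2) (c := z ^ 2)
    (k := l * eval ![x, y, z, 0] f2) (pow_ne_zero 2 hx)
    (pow_ne_zero 2 hy) (pow_ne_zero 2 hz) (by linear_combination h1) hK ?_ ?_ ?_
  · refine (mul_eq_zero.1 (?_ : (2 * x) * _ = 0)).resolve_left (by simpa using hx)
    linear_combination h0
  · refine (mul_eq_zero.1 (?_ : (2 * y) * _ = 0)).resolve_left (by simpa using hy)
    linear_combination h1'
  · refine (mul_eq_zero.1 (?_ : (2 * z) * _ = 0)).resolve_left (by simpa using hz)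
    linear_combination h2

end SimplePoints

end G29

/-! ### Orders of vanishing at points of the quartic with `x = 0` -/

namespace G29

noncomputable section

variable {l m : ℂ} {p : MvPolynomial (Fin 4) ℂ}

/-- A curve germ on the plane quartic `t = f₁ = 0` at the point `(0, y, z, 0)`, up to order `3`. -/
def germ (y y' z : ℂ) : Fin 4 → Polynomial ℂ :=
  ![Polynomial.X, Polynomial.C y + Polynomial.C y' * Polynomial.X ^ 2, Polynomial.C z, 0]

theorem eval_zero_aeval_germ (y y' z : ℂ) (q : MvPolynomial (Fin 4) ℂ) :
    (aeval (germ y y' z) q).eval 0 = eval ![0, y, z, 0] q := by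
  have : (Polynomial.aeval (0 : ℂ)).comp (aeval (germ y y' z)) =
      (aeval ![0, y, z, 0] : MvPolynomial (Fin 4) ℂ →ₐ[ℂ] ℂ) := by
    ext1 i
    fin_cases i <;> simp [germ]
  have h := DFunLike.congr_fun this q
  rw [AlgHom.comp_apply, Polynomial.coe_aeval_eq_eval] at h
  exact h

theorem X_dvd_aeval_germ {y y' z : ℂ} {q : MvPolynomial (Fin 4) ℂ}
    (h : eval ![0, y, z, 0] q = 0) : Polynomial.X ∣ aeval (germ y y' z) q := by
  rw [Polynomial.X_dvd_iff, Polynomial.coeff_zero_eq_eval_zero, eval_zero_aeval_germ, h]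

/-- The dodecics vanish to order exactly `2` along the germ. -/
theorem exists_germ_order (l m : ℂ) {y z : ℂ} (hy : y ≠ 0) (hz : z ≠ 0)
    (h1 : eval ![0, y, z, 0] f1 = 0) :
    ∃ y', ¬ Polynomial.X ^ 3 ∣ aeval (germ y y' z) (dodecic l m) := by
  have h0 : y ^ 4 - 6 * y ^ 2 * z ^ 2 + z ^ 4 = 0 := by
    rw [eval_f1] at h1; simp only [e1, e2] at h1; linear_combination h1
  have hy2 : y ^ 2 - z ^ 2 ≠ 0 := by
    intro h
    have : y ^ 2 * y ^ 2 = 0 := by linear_combination (5 * y ^ 2 - z ^ 2) * h / 4 - h0 / 4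
    simp [hy] at this
  have hy3 : y ^ 2 - 3 * z ^ 2 ≠ 0 := by
    intro h
    have : z ^ 2 * z ^ 2 = 0 := by linear_combination (y ^ 2 - 3 * z ^ 2) * h / 8 - h0 / 8
    simp [hz] at this
  have hy4 : y ^ 2 + z ^ 2 ≠ 0 := by
    intro h
    have : z ^ 2 * z ^ 2 = 0 := by linear_combination h0 / 8 - (y ^ 2 - 7 * z ^ 2) * h / 8
    simp [hz] at this
  -- The value of `a` cancels the coefficient of `X²` in `f1` along the germ; it exists because
  -- `4y(y² - 3z²) ≠ 0`.
  obtain ⟨a, ha⟩ : ∃ a : ℂ, a * (4 * y ^ 3 - 12 * y * z ^ 2) - 6 * (y ^ 2 + z ^ 2) = 0 := by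
    have : 4 * y ^ 3 - 12 * y * z ^ 2 ≠ 0 := by
      rw [show 4 * y ^ 3 - 12 * y * z ^ 2 = 4 * y * (y ^ 2 - 3 * z ^ 2) by ring]
      exact mul_ne_zero (by simpa using hy) hy3
    exact ⟨6 * (y ^ 2 + z ^ 2) / (4 * y ^ 3 - 12 * y * z ^ 2), by rw [div_mul_cancel₀ _ this, sub_self]⟩
  refine ⟨a, ?_⟩
  -- Along the germ `f1` is even in `X`, so once the coefficients of degrees 0 and 2 vanish it has
  -- order at least 4. Modulo `X³` only `f3` then contributes to the dodecic.
  obtain ⟨k, hk⟩ : Polynomial.X ^ 4 ∣ aeval (germ y a z) f1 := by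
    rw [germ, aeval_f1]
    have h0' := congrArg Polynomial.C h0
    have ha' := congrArg Polynomial.C ha
    simp only [map_add, map_sub, map_mul, map_pow, map_ofNat, map_zero] at h0' ha'
    generalize (Polynomial.C y : Polynomial ℂ) = Y at *
    generalize (Polynomial.C z : Polynomial ℂ) = Z at *
    generalize (Polynomial.C a : Polynomial ℂ) = A at *
    generalize (Polynomial.X : Polynomial ℂ) = T at *
    refine ⟨(1 + 6 * Y ^ 2 * A ^ 2 - 12 * Y * A - 6 * Z ^ 2 * A ^ 2) +
      (4 * Y * A ^ 3 - 6 * A ^ 2) * T ^ 2 + A ^ 4 * T ^ 4, ?_⟩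
    simp only [e1, e2]
    linear_combination h0' + T ^ 2 * ha'
  intro hdvd
  rw [aeval_dodecic, hk] at hdvd
  have h3 : Polynomial.X ^ 3 ∣ aeval (germ y a z) f3 := by
    rw [add_assoc, mul_pow] at hdvd
    refine (dvd_add_left (dvd_add ?_ ?_)).1 hdvd
    · exact Dvd.dvd.mul_left (Dvd.dvd.mul_left (Dvd.dvd.mul_right (pow_dvd_pow _ (by norm_num)) _) _) _
    · rw [← pow_mul]
      exact Dvd.dvd.mul_left (Dvd.dvd.mul_right (pow_dvd_pow _ (by norm_num)) _) _
  rw [germ, aeval_f3] at h3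
  obtain ⟨q, hq⟩ := h3
  have hX : (Polynomial.X : Polynomial ℂ) ^ 2 ≠ 0 := pow_ne_zero 2 Polynomial.X_ne_zero
  -- Since `e4 = 0` on the germ, `f3` is `X²` times an explicit factor, which would have to vanish
  -- at `X = 0`.
  have hu := mul_left_cancel₀ hX (show Polynomial.X ^ 2 *
    (((Polynomial.C y + Polynomial.C a * Polynomial.X ^ 2) * Polynomial.C z) ^ 2 *
      (e1 Polynomial.X (Polynomial.C y + Polynomial.C a * Polynomial.X ^ 2) (Polynomial.C z) 0 ^ 3 -
      4 * e1 Polynomial.X (Polynomial.C y + Polynomial.C a * Polynomial.X ^ 2) (Polynomial.C z) 0 *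
        e2 Polynomial.X (Polynomial.C y + Polynomial.C a * Polynomial.X ^ 2) (Polynomial.C z) 0 +
      4 * e3 Polynomial.X (Polynomial.C y + Polynomial.C a * Polynomial.X ^ 2) (Polynomial.C z) 0)) =
    Polynomial.X ^ 2 * (Polynomial.X * q) by
      rw [← mul_assoc _ Polynomial.X q, ← pow_succ, ← hq]
      simp only [e3, e4]
      ring)
  have he := congrArg (Polynomial.eval 0) hu
  simp only [e1, e2, e3, Polynomial.eval_mul, Polynomial.eval_add, Polynomial.eval_sub,
    Polynomial.eval_pow, Polynomial.eval_C, Polynomial.eval_X, Polynomial.eval_ofNat,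
    Polynomial.eval_zero] at he
  have : (y * z) ^ 2 * ((y ^ 2 + z ^ 2) * (y ^ 2 - z ^ 2) ^ 2) = 0 := by linear_combination he
  exact mul_ne_zero (pow_ne_zero 2 (mul_ne_zero hy hz)) (mul_ne_zero hy4 (pow_ne_zero 2 hy2)) this

/-- At most two factors of a dodecic vanish at a point of the plane quartic with `x = 0`. -/
theorem three_factors_absurd {a b c s : MvPolynomial (Fin 4) ℂ} {y z : ℂ}
    (hF : dodecic l m = a * b * c * s) (hy : y ≠ 0) (hz : z ≠ 0)
    (h1 : eval ![0, y, z, 0] f1 = 0) (ha : eval ![0, y, z, 0] a = 0)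
    (hb : eval ![0, y, z, 0] b = 0) (hc : eval ![0, y, z, 0] c = 0) : False := by
  obtain ⟨y', h⟩ := exists_germ_order l m hy hz h1
  apply h
  rw [hF, map_mul, map_mul, map_mul, pow_succ, pow_two]
  exact Dvd.dvd.mul_right (mul_dvd_mul (mul_dvd_mul (X_dvd_aeval_germ ha) (X_dvd_aeval_germ hb))
    (X_dvd_aeval_germ hc)) _

end

/-- A nonzero point of the plane quartic `t = f₁ = 0` with `x = 0` has its two other coordinates
nonzero. -/
theorem ne_zero_of_eval_f1 {y z : ℂ} (h1 : eval ![0, y, z, 0] f1 = 0) (h : y ≠ 0 ∨ z ≠ 0) :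
    y ≠ 0 ∧ z ≠ 0 := by
  rw [eval_f1] at h1; simp only [e1, e2] at h1
  constructor
  · rintro rfl
    have : z ^ 4 = 0 := by linear_combination h1
    simp_all
  · rintro rfl
    have : y ^ 4 = 0 := by linear_combination h1
    simp_all

/-- `p` is an irreducible factor of the dodecic moved by the reflection `t ↦ -t`. -/
structure MovedFactor (l m : ℂ) (p : MvPolynomial (Fin 4) ℂ) : Prop where
  irreducible : Irreducible p
  dvd : p ∣ dodecic l m
  moved : ¬ Associated p (matSubst (sgn 3) p)

theorem Fixes.irreducible_and_dvd {M : Matrix (Fin 4) (Fin 4) ℂ} (hM : Fixes M) (hMM : M * M = 1)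
    (hp : Irreducible p) (hpF : p ∣ G29.dodecic l m) :
    Irreducible (matSubst M p) ∧ matSubst M p ∣ G29.dodecic l m :=
  ⟨(irreducible_matSubst_iff p hMM).2 hp,
    by simpa only [hM.dodecic] using map_dvd (matSubst M) hpF⟩

namespace MovedFactor

theorem eval_sgn_three {x y z t : ℂ} :
    eval ![x, y, z, t] (matSubst (sgn 3) p) = eval ![x, y, z, -t] p := by
  rw [eval_matSubst, sgn_three_mulVec]

theorem eval_sgn_zero {x y z t : ℂ} :
    eval ![x, y, z, t] (matSubst (sgn 0) p) = eval ![-x, y, z, t] p := by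
  rw [eval_matSubst, sgn_zero_mulVec]

/-- The germ lies in `t = 0`, so `p` and its image under `t ↦ -t` have the same order along it.
Order 2 each would give the dodecic order at least 4. -/
theorem not_X_sq_dvd (h : MovedFactor l m p) {y z : ℂ} (hy : y ≠ 0) (hz : z ≠ 0)
    (h1 : eval ![0, y, z, 0] f1 = 0) :
    ∃ y', ¬ Polynomial.X ^ 2 ∣ aeval (germ y y' z) p := by
  obtain ⟨y', h'⟩ := exists_germ_order l m hy hz h1
  refine ⟨y', fun hd => h' ?_⟩
  obtain ⟨hi, hD⟩ := (fixes_sgn 3).irreducible_and_dvd (sgn_mul_self 3) h.irreducible h.dvd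
  obtain ⟨s, hs⟩ := exists_eq_mul_mul h.irreducible hi h.dvd hD h.moved
  have hev : aeval (germ y y' z) (matSubst (sgn 3) p) = aeval (germ y y' z) p := by
    rw [aeval_matSubst]
    congr 2
    ext1 i
    fin_cases i <;> simp [germ, sgn, Fin.sum_univ_four]
  rw [hs, map_mul, map_mul, hev]
  refine Dvd.dvd.mul_right ?_ _
  exact (pow_dvd_pow _ (by norm_num : 3 ≤ 2 + 2)).trans (by rw [pow_add]; exact mul_dvd_mul hd hd)

/-- If the image of `p` under `M` were a third factor through the point, the dodecic would have
order at least 3 along the germ. -/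
theorem associated_or (h : MovedFactor l m p) {y z : ℂ} (hy : y ≠ 0) (hz : z ≠ 0)
    (h1 : eval ![0, y, z, 0] f1 = 0) (h0 : eval ![0, y, z, 0] p = 0)
    {M : Matrix (Fin 4) (Fin 4) ℂ} (hM : Fixes M) (hMM : M * M = 1)
    (hM0 : eval ![0, y, z, 0] (matSubst M p) = 0) :
    Associated p (matSubst M p) ∨ Associated (matSubst (sgn 3) p) (matSubst M p) := by
  by_contra! hcon
  obtain ⟨hi, hD⟩ := (fixes_sgn 3).irreducible_and_dvd (sgn_mul_self 3) h.irreducible h.dvd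
  obtain ⟨hi', hD'⟩ := hM.irreducible_and_dvd hMM h.irreducible h.dvd
  obtain ⟨s, hs⟩ := exists_eq_mul_mul_mul h.irreducible hi hi' h.dvd hD hD' h.moved hcon.1 hcon.2
  exact three_factors_absurd hs hy hz h1 h0 (by rw [eval_sgn_three, neg_zero, h0]) hM0

/-- The reflections `x ↦ -x` and `t ↦ -t` act on a moved factor vanishing on the curve at a point
with `x = 0` in opposite ways. -/
theorem eval_neg_first (h : MovedFactor l m p) {y z : ℂ} (hy : y ≠ 0) (hz : z ≠ 0)
    (h1 : eval ![0, y, z, 0] f1 = 0) (h0 : eval ![0, y, z, 0] p = 0) (a b c d : ℂ) :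
    eval ![-a, b, c, d] p = - eval ![a, b, c, -d] p := by
  obtain ⟨y', hX2⟩ := h.not_X_sq_dvd hy hz h1
  -- The other coordinates of the germ are even in `X`, so `x ↦ -x` acts on it as `X ↦ -X`.
  have hev : ∀ q, aeval (germ y y' z) (matSubst (sgn 0) q) =
      (aeval (germ y y' z) q).comp (-Polynomial.X) := by
    intro q
    rw [aeval_matSubst]
    have : (aeval fun i => ∑ j, algebraMap ℂ (Polynomial ℂ) (sgn 0 i j) * germ y y' z j) =
        (Polynomial.aeval (-Polynomial.X : Polynomial ℂ)).comp (aeval (germ y y' z)) := by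
      ext1 i
      fin_cases i <;> simp [germ, sgn, Fin.sum_univ_four]
    rw [this]; rfl
  have hev3 : aeval (germ y y' z) (matSubst (sgn 3) p) = aeval (germ y y' z) p := by
    rw [aeval_matSubst]
    congr 2
    ext1 i
    fin_cases i <;> simp [germ, sgn, Fin.sum_univ_four]
  obtain ⟨q, hq⟩ := X_dvd_aeval_germ (y' := y') h0
  have hq0 : q.coeff 0 ≠ 0 := by
    intro hq0
    obtain ⟨r, rfl⟩ := Polynomial.X_dvd_iff.2 hq0
    exact hX2 ⟨r, by rw [hq]; ring⟩
  -- Along the germ `p` has a simple zero, and its linear coefficient changes sign under `X ↦ -X`;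
  -- so any proportionality constant is `-1`.
  have hc : ∀ c : ℂ, (aeval (germ y y' z) p).comp (-Polynomial.X) =
      Polynomial.C c * aeval (germ y y' z) p → c = -1 := by
    intro c hc
    rw [hq, Polynomial.mul_comp, Polynomial.X_comp] at hc
    have h2 : -(q.comp (-Polynomial.X)) = Polynomial.C c * q :=
      mul_left_cancel₀ Polynomial.X_ne_zero (by linear_combination hc)
    have h3 := congrArg (Polynomial.eval 0) h2
    simp only [Polynomial.eval_neg, Polynomial.eval_comp, Polynomial.eval_X, neg_zero,
      Polynomial.eval_mul, Polynomial.eval_C] at h3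
    rw [Polynomial.coeff_zero_eq_eval_zero] at hq0
    refine mul_right_cancel₀ hq0 (by rw [← h3]; ring)
  rcases h.associated_or hy hz h1 h0 (fixes_sgn 0) (sgn_mul_self 0)
    (by rw [eval_sgn_zero, neg_zero, h0]) with hA | hA
  · obtain ⟨k, -, hk⟩ := exists_C_mul_of_associated hA
    have hk' := congrArg (aeval (germ y y' z)) hk
    rw [hev, map_mul, algHom_C, ← Polynomial.C_eq_algebraMap] at hk'
    obtain rfl := hc k hk'
    -- Here `p` would be odd in `x` and vanish on the plane `x = 0`, contrary to its value at `(0,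
    -- 1, w, w²)`.
    exfalso
    obtain ⟨w, hw⟩ := exists_cube_root
    refine eval_ne_zero_of_dvd_first h.dvd hw ?_
    have := congrArg (eval ![0, 1, w, w ^ 2]) hk
    rw [eval_sgn_zero, neg_zero, map_mul, eval_C] at this
    linear_combination this / 2
  · obtain ⟨k, -, hk⟩ := exists_C_mul_of_associated hA
    have hk' := congrArg (aeval (germ y y' z)) hk
    rw [hev, map_mul, algHom_C, ← Polynomial.C_eq_algebraMap, hev3] at hk'
    obtain rfl := hc k hk'
    have := congrArg (eval ![a, b, c, d]) hk
    rw [eval_sgn_zero, map_mul, eval_sgn_three, eval_C] at this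
    rw [this, neg_one_mul]

end MovedFactor

end G29

/-! ### No factor is moved by `t ↦ -t` -/

namespace G29

variable {l m : ℂ} {p : MvPolynomial (Fin 4) ℂ}

theorem dodecic_ne_zero (l m : ℂ) : dodecic l m ≠ 0 := by
  obtain ⟨w, hw⟩ := exists_cube_root
  intro h
  exact eval_ne_zero_of_dvd_last (dvd_refl (dodecic l m)) hw (by rw [h, map_zero])

theorem exists_isHomogeneous_of_dvd (hp : Irreducible p) (hpF : p ∣ dodecic l m) :
    ∃ d, d ≠ 0 ∧ p.IsHomogeneous d := by
  obtain ⟨q, hq⟩ := hpF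
  obtain ⟨d, -, hd, -⟩ := (hq ▸ dodecic_isHomogeneous l m).exists_of_mul
    (hq ▸ dodecic_ne_zero l m)
  refine ⟨d, ?_, hd⟩
  rintro rfl
  have h0 := totalDegree_eq_zero_iff_eq_C.1 ((totalDegree_zero_iff_isHomogeneous _).2 hd)
  refine hp.not_isUnit ?_
  rw [h0, isUnit_map_iff, isUnit_iff_ne_zero]
  intro hc
  exact hp.ne_zero (by rw [h0, hc, map_zero])

/-- A form of positive degree vanishes somewhere on the plane quartic `t = f₁ = 0`. -/
theorem exists_zero_on_quartic {d : ℕ} (hd : d ≠ 0) (hp : p.IsHomogeneous d) :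
    ∃ x y z : ℂ, ¬ (x = 0 ∧ y = 0 ∧ z = 0) ∧ eval ![x, y, z, 0] f1 = 0 ∧
      eval ![x, y, z, 0] p = 0 := by
  classical
  obtain ⟨v, hv0, hv⟩ := exists_ne_zero_forall_eval_eq_zero ({p, f1, X 3} : Finset _)
    (lt_of_le_of_lt Finset.card_le_three (by norm_num)) (by
      simp only [Finset.mem_insert, Finset.mem_singleton]
      rintro q (rfl | rfl | rfl)
      · exact hp.eval_zero_eq_zero hd
      · exact f1_isHomogeneous.eval_zero_eq_zero (by norm_num)
      · simp)
  have h3 : v 3 = 0 := by simpa using hv (X 3) (by simp)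
  have hv' : v = ![v 0, v 1, v 2, 0] := by
    ext i; fin_cases i <;> simp [h3]
  refine ⟨v 0, v 1, v 2, ?_, ?_, ?_⟩
  · rintro ⟨h0, h1, h2⟩
    exact hv0 (by rw [hv', h0, h1, h2]; ext i; fin_cases i <;> rfl)
  · rw [← hv']; exact hv _ (by simp)
  · rw [← hv']; exact hv _ (by simp)

theorem swp_zero_one_mulVec (x y z t : ℂ) : (swp 0 1).mulVec ![x, y, z, t] = ![y, x, z, t] := by
  rw [swp_mulVec_four]; rfl

theorem swp_zero_two_mulVec (x y z t : ℂ) : (swp 0 2).mulVec ![x, y, z, t] = ![z, y, x, t] := by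
  rw [swp_mulVec_four]; rfl

theorem swp_zero_three_mulVec (x y z t : ℂ) :
    (swp 0 3).mulVec ![x, y, z, t] = ![t, y, z, x] := by
  rw [swp_mulVec_four]; rfl

theorem swp_mul_sgn_mul_swp {j : Fin 4} (hj : j ≠ 3) : swp 0 j * sgn 3 * swp 0 j = sgn 3 := by
  have h : Equiv.swap 0 j 3 = 3 := Equiv.swap_apply_of_ne_of_ne (by decide) hj.symm
  refine Matrix.toLin'.injective <| LinearMap.ext fun v => ?_
  ext a
  simp only [Matrix.toLin'_mul, LinearMap.comp_apply, Matrix.toLin'_apply, swp_mulVec, sgn_mulVec,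
    Equiv.swap_apply_self]
  congr 1
  rw [eq_iff_iff, Equiv.swap_apply_eq_iff, h]

namespace MovedFactor

/-- Transpositions not involving `t` commute with `t ↦ -t`, so the notion is stable. Zeros with `y =
0` or `z = 0` thus reduce to zeros with `x = 0`. -/
theorem swp (h : MovedFactor l m p) {j : Fin 4} (hj : j ≠ 3) :
    MovedFactor l m (matSubst (swp 0 j) p) := by
  obtain ⟨hi, hd⟩ := (fixes_swp 0 j).irreducible_and_dvd (swp_mul_self 0 j) h.irreducible h.dvd
  refine ⟨hi, hd, fun hA => h.moved ?_⟩
  have := hA.map (matSubst (G29.swp 0 j))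
  rwa [matSubst_matSubst, matSubst_matSubst, matSubst_matSubst, swp_mul_self, matSubst_one,
    ← mul_assoc, swp_mul_sgn_mul_swp hj] at this

/-- The constant of proportionality would square to 1. The value `-1` makes `p` vanish on the mirror
`x = t`; the value 1, combined with `hx`, gives vanishing at the points `(1, y, 0, -1)` of the
mirror `x = -t`. Each mirror contains a test point where `p` is nonzero. -/
theorem not_associated_swp (h : MovedFactor l m p)
    (hx : ∀ a b c d, eval ![-a, b, c, d] p = - eval ![a, b, c, -d] p) :
    ¬ Associated p (matSubst (G29.swp 0 3) p) := by
  intro hA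
  obtain ⟨k, -, hk⟩ := exists_C_mul_of_associated hA
  have hP : ∀ x y z t, eval ![t, y, z, x] p = k * eval ![x, y, z, t] p := by
    intro x y z t
    have := congrArg (eval ![x, y, z, t]) hk
    rwa [eval_matSubst, swp_zero_three_mulVec, map_mul, eval_C] at this
  obtain ⟨w, hw⟩ := exists_cube_root
  have h0 := eval_ne_zero_of_dvd_last h.dvd hw
  have hk2 : k ^ 2 = 1 := by
    refine mul_right_cancel₀ h0 ?_
    linear_combination -k * hP 1 w (w ^ 2) 0 - hP 0 w (w ^ 2) 1
  rcases mul_self_eq_one_iff.1 ((sq k).symm.trans hk2) with rfl | rfl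
  · obtain ⟨y, hy⟩ := exists_eval_ne_zero_mirror h.dvd (-1) (by norm_num)
    refine hy ?_
    have e1 := hP 1 y 0 (-1)
    have e2 := hx 1 y 0 1
    linear_combination (-e1 + e2) / 2
  · obtain ⟨y, hy⟩ := exists_eval_ne_zero_mirror h.dvd 1 (by norm_num)
    refine hy ?_
    linear_combination hP 1 y 0 1 / 2

/-- A moved factor does not vanish on the plane quartic at a point with `x = 0`. -/
theorem eval_zero_ne (h : MovedFactor l m p) {y z : ℂ} (hy : y ≠ 0) (hz : z ≠ 0)
    (h1 : eval ![0, y, z, 0] f1 = 0) (h0 : eval ![0, y, z, 0] p = 0) : False := by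
  have hx := h.eval_neg_first hy hz h1 h0
  obtain ⟨k, -, hk⟩ := exists_C_mul_of_associated ((h.associated_or hy hz h1 h0 (fixes_swp 0 3)
    (swp_mul_self 0 3) (by rw [eval_matSubst, swp_zero_three_mulVec, h0])).resolve_left
    (h.not_associated_swp hx))
  have hP : ∀ x y z t, eval ![t, y, z, x] p = k * eval ![x, y, z, -t] p := by
    intro x y z t
    have := congrArg (eval ![x, y, z, t]) hk
    rwa [eval_matSubst, swp_zero_three_mulVec, map_mul, eval_C, eval_sgn_three] at this
  obtain ⟨w, hw⟩ := exists_cube_root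
  have hv := eval_ne_zero_of_dvd_last h.dvd hw
  -- Applying the exchange of `x` and `t` twice to `(1, w, w², 0)` gives `k²`, up to the sign
  -- supplied by `hx`.
  have hk0 : k ^ 2 = -1 := by
    refine mul_right_cancel₀ hv ?_
    have e1 := hP 1 w (w ^ 2) 0
    have e2 := hP 0 w (w ^ 2) 1
    have e3 := hx 0 w (w ^ 2) 1
    rw [neg_zero] at e1 e3
    linear_combination -k * e1 + e2 + k * e3
  have hkne : k ≠ 0 := by rintro rfl; norm_num at hk0
  -- the other zeros of `p` on the plane quartic have `x = 0` as well
  have hY : ∀ a c : ℂ, a ≠ 0 → eval ![a, 0, c, 0] f1 = 0 → eval ![a, 0, c, 0] p ≠ 0 := by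
    intro a c ha hf hp0
    have hf' : eval ![0, a, c, 0] f1 = 0 := by
      rw [← (fixes_swp 0 1).f1, eval_matSubst, swp_zero_one_mulVec, hf]
    obtain ⟨-, hc⟩ := ne_zero_of_eval_f1 hf' (Or.inl ha)
    have hy' := (h.swp (j := 1) (by decide)).eval_neg_first ha hc hf'
      (by rw [eval_matSubst, swp_zero_one_mulVec, hp0])
    simp only [eval_matSubst, swp_zero_one_mulVec] at hy'
    have e1 := hP 1 (-w) (w ^ 2) 0
    have e2 := hy' w 1 (w ^ 2) 0
    have e3 := hy' w 0 (w ^ 2) 1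
    have e4 := hP (-1) w (w ^ 2) 0
    have e5 := hx 1 w (w ^ 2) 0
    rw [neg_zero] at e1 e2 e4 e5
    -- The sign rule now holds for `y` as well as for `x`. Carried through the exchange `hP`, the
    -- two rules give opposite values of `p` at `(0, w, w², -1)`, namely `k` and `-k` times its
    -- value at `(1, w, w², 0)`.
    have : k * eval ![1, w, w ^ 2, 0] p = 0 := by
      linear_combination (e1 + k * e2 - e3 + e4 + k * e5) / 2
    exact mul_ne_zero hkne hv this
  have hZ : ∀ a b : ℂ, a ≠ 0 → eval ![a, b, 0, 0] f1 = 0 → eval ![a, b, 0, 0] p ≠ 0 := by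
    intro a b ha hf hp0
    have hf' : eval ![0, b, a, 0] f1 = 0 := by
      rw [← (fixes_swp 0 2).f1, eval_matSubst, swp_zero_two_mulVec, hf]
    obtain ⟨hb, -⟩ := ne_zero_of_eval_f1 hf' (Or.inr ha)
    have hz' := (h.swp (j := 2) (by decide)).eval_neg_first hb ha hf'
      (by rw [eval_matSubst, swp_zero_two_mulVec, hp0])
    simp only [eval_matSubst, swp_zero_two_mulVec] at hz'
    have e1 := hP 1 w (-w ^ 2) 0
    have e2 := hz' (w ^ 2) w 1 0
    have e3 := hz' (w ^ 2) w 0 1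
    have e4 := hP (-1) w (w ^ 2) 0
    have e5 := hx 1 w (w ^ 2) 0
    rw [neg_zero] at e1 e2 e4 e5
    have : k * eval ![1, w, w ^ 2, 0] p = 0 := by
      linear_combination (e1 + k * e2 - e3 + e4 + k * e5) / 2
    exact mul_ne_zero hkne hv this
  -- the restriction of `p` to the plane is divisible by `x`
  obtain ⟨d, hd0, hd⟩ := exists_isHomogeneous_of_dvd h.irreducible h.dvd
  set r : MvPolynomial (Fin 4) ℂ :=
    aeval ![X 0, X 1, X 2, (0 : MvPolynomial (Fin 4) ℂ)] p with hr
  have hrA : ∀ {A : Type} [CommRing A] [Algebra ℂ A] (x y z t : A),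
      aeval ![x, y, z, t] r = aeval ![x, y, z, 0] p := by
    intro A _ _ x y z t
    rw [hr, ← AlgHom.comp_apply, comp_aeval]
    congr 2
    ext1 i
    fin_cases i <;> simp
  have hre : ∀ x y z t : ℂ, eval ![x, y, z, t] r = eval ![x, y, z, 0] p := hrA
  have hr0 : r ≠ 0 := by
    intro h0
    exact hv (by rw [← hre _ _ _ 0, h0, map_zero])
  obtain ⟨q, hq⟩ : X 0 ∣ r := by
    refine X_dvd_of_aeval_update_eq_zero 0 r (eval_four fun x y z t => ?_)
    have : eval ![x, y, z, t] (aeval (Function.update X 0 (0 : MvPolynomial (Fin 4) ℂ)) r) =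
        eval ![0, y, z, t] r := by
      have e : (aeval ![x, y, z, t] : MvPolynomial (Fin 4) ℂ →ₐ[ℂ] ℂ).comp
          (aeval (Function.update X 0 (0 : MvPolynomial (Fin 4) ℂ))) = aeval ![0, y, z, t] := by
        ext1 i
        fin_cases i <;> simp
      exact DFunLike.congr_fun e r
    rw [this, hre, map_zero]
    have := hx 0 y z 0
    rw [neg_zero] at this
    linear_combination this / 2
  have hrd : r.IsHomogeneous d := by
    have := hd.aeval (n := 1) ![X 0, X 1, X 2, (0 : MvPolynomial (Fin 4) ℂ)] fun i => by
      fin_cases i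
      exacts [isHomogeneous_X _ _, isHomogeneous_X _ _, isHomogeneous_X _ _, isHomogeneous_zero _ _ _]
    rwa [one_mul] at this
  obtain ⟨a, e, ha, he, hae⟩ := (hq ▸ hrd).exists_of_mul (hq ▸ hr0)
  obtain rfl : a = 1 := ha.inj_right (isHomogeneous_X _ _) (X_ne_zero _)
  have hpq : ∀ x y z : ℂ, eval ![x, y, z, 0] p = x * eval ![x, y, z, 0] q := by
    intro x y z
    rw [← hre x y z 0, hq, map_mul, eval_X]
    rfl
  -- If the cofactor `q` is constant, `p` is linear and proportional to `x + k t`, and the test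
  -- point on that plane excludes it.
  by_cases he0 : e = 0
  · subst he0
    obtain ⟨c, rfl⟩ : ∃ c, q = C c :=
      ⟨_, totalDegree_eq_zero_iff_eq_C.1 ((totalDegree_zero_iff_isHomogeneous _).2 he)⟩
    obtain rfl : d = 1 := by omega
    obtain ⟨y, hy⟩ := exists_eval_ne_zero_plane h.dvd k hk0
    refine hy ?_
    have e0 : (![-k, y, 0, 1] : Fin 4 → ℂ) = ![-k, y, 0, 0] + ![0, 0, 0, 1] := by
      ext i; fin_cases i <;> simp
    have e1 := hpq (-k) y 0
    have e2 := hpq 1 0 0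
    have e3 := hP 0 0 0 1
    have e4 := hx 0 0 0 1
    rw [eval_C] at e1 e2
    rw [neg_zero] at e4
    rw [e0, hd.eval_add_of_one]
    linear_combination e1 + k * e2 - k * e3 + e4 -
      eval ![0, 0, 0, -1] p * hk0
  -- Otherwise `q` has a zero on the quartic. At `x = 0` it would give `p = x q` order 2 along the
  -- germ; elsewhere `hY`, `hZ` and transversality exclude it.
  · obtain ⟨x, y, z, hxyz, hf, hq0⟩ := exists_zero_on_quartic he0 he
    have hp0 : eval ![x, y, z, 0] p = 0 := by rw [hpq, hq0, mul_zero]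
    by_cases hx0 : x = 0
    · subst hx0
      obtain ⟨hy, hz⟩ := ne_zero_of_eval_f1 hf (by tauto)
      obtain ⟨y', hn⟩ := h.not_X_sq_dvd hy hz hf
      refine hn ?_
      have := hrA (Polynomial.X : Polynomial ℂ)
        (Polynomial.C y + Polynomial.C y' * Polynomial.X ^ 2) (Polynomial.C z) 0
      have hX := X_dvd_aeval_germ (y' := y') hq0
      rw [germ] at hX ⊢
      obtain ⟨s, hs⟩ := hX
      refine ⟨s, ?_⟩
      rw [← this, hq, map_mul, aeval_X, hs, Matrix.cons_val_zero]
      ring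
    · have := mul_mul_eq_zero_of_moved h.irreducible h.dvd h.moved hf hp0
      rcases mul_eq_zero.1 this with h' | rfl
      · obtain rfl := (mul_eq_zero.1 h').resolve_left hx0
        exact hY x z hx0 hf hp0
      · exact hZ x y hx0 hf hp0

theorem absurd (h : MovedFactor l m p) : False := by
  obtain ⟨d, hd0, hd⟩ := exists_isHomogeneous_of_dvd h.irreducible h.dvd
  obtain ⟨x, y, z, hxyz, hf, hp0⟩ := exists_zero_on_quartic hd0 hd
  have := mul_mul_eq_zero_of_moved h.irreducible h.dvd h.moved hf hp0
  rcases mul_eq_zero.1 this with h' | rfl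
  · rcases mul_eq_zero.1 h' with rfl | rfl
    · obtain ⟨hy, hz⟩ := ne_zero_of_eval_f1 hf (by tauto)
      exact h.eval_zero_ne hy hz hf hp0
    · have hf' : eval ![0, x, z, 0] f1 = 0 := by
        rw [← (fixes_swp 0 1).f1, eval_matSubst, swp_zero_one_mulVec, hf]
      obtain ⟨hy, hz⟩ := ne_zero_of_eval_f1 hf' (by tauto)
      exact (h.swp (j := 1) (by decide)).eval_zero_ne hy hz hf'
        (by rw [eval_matSubst, swp_zero_one_mulVec, hp0])
  · have hf' : eval ![0, y, x, 0] f1 = 0 := by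
      rw [← (fixes_swp 0 2).f1, eval_matSubst, swp_zero_two_mulVec, hf]
    obtain ⟨hy, hz⟩ := ne_zero_of_eval_f1 hf' (by tauto)
    exact (h.swp (j := 2) (by decide)).eval_zero_ne hy hz hf'
      (by rw [eval_matSubst, swp_zero_two_mulVec, hp0])

end MovedFactor

end G29

/-! ### Factors are fixed by all reflections, and irreducibility -/

namespace G29

variable {l m : ℂ} {p : MvPolynomial (Fin 4) ℂ}

/-- The substitution of `M` leaves every irreducible factor of the dodecic unchanged. -/
def FixesFactors (l m : ℂ) (M : Matrix (Fin 4) (Fin 4) ℂ) : Prop :=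
  ∀ p, Irreducible p → p ∣ dodecic l m → matSubst M p = p

theorem fixesFactors_sgn (l m : ℂ) : FixesFactors l m (sgn 3) := by
  intro p hp hpF
  by_cases hA : Associated p (matSubst (sgn 3) p)
  · obtain ⟨k, -, hk⟩ := exists_C_mul_of_associated hA
    obtain ⟨w, hw⟩ := exists_cube_root
    have h0 := eval_ne_zero_of_dvd_last hpF hw
    have := congrArg (eval ![1, w, w ^ 2, 0]) hk
    rw [eval_matSubst, sgn_three_mulVec, neg_zero, map_mul, eval_C] at this
    -- The test point lies on `t = 0`, so the reflection fixes it and leaves the nonzero value of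
    -- `p` unchanged.
    obtain rfl : k = 1 := mul_right_cancel₀ h0 (by rw [← this, one_mul])
    rw [hk, map_one, one_mul]
  · exact (MovedFactor.absurd ⟨hp, hpF, hA⟩).elim

namespace FixesFactors

variable {A B M : Matrix (Fin 4) (Fin 4) ℂ}

theorem mul (hA : FixesFactors l m A) (hB : FixesFactors l m B) : FixesFactors l m (A * B) := by
  intro p hp hpF
  rw [← matSubst_matSubst, hA p hp hpF, hB p hp hpF]

/-- A symmetry `M` of the dodecic permutes its irreducible factors. Quantifying over all factors in
`FixesFactors` is what makes the property stable under conjugation. -/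
theorem conj (hA : FixesFactors l m A) (hM : Fixes M) (hMM : M * M = 1) :
    FixesFactors l m (M * A * M) := by
  intro p hp hpF
  obtain ⟨hi, hd⟩ := hM.irreducible_and_dvd hMM hp hpF
  rw [← matSubst_matSubst, ← matSubst_matSubst, hA _ hi hd, matSubst_matSubst, hMM, matSubst_one]

end FixesFactors

theorem fixes_matS1 : Fixes matS1 := swp_zero_one ▸ fixes_swp 0 1

theorem fixes_matS2 : Fixes matS2 := swp_one_two ▸ fixes_swp 1 2

theorem fixesFactors_matR (l m : ℂ) : FixesFactors l m matR := by
  rw [matR_eq_conj]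
  exact ((fixesFactors_sgn l m).conj fixes_matR matR_mul_self).conj (fixes_sgn 3) (sgn_mul_self 3)

theorem fixesFactors_matS2 (l m : ℂ) : FixesFactors l m matS2 := by
  rw [matS2_eq_conj]
  exact ((fixesFactors_matR l m).conj fixes_matS2 matS2_mul_self).conj fixes_matR matR_mul_self

theorem fixesFactors_matS1 (l m : ℂ) : FixesFactors l m matS1 := by
  rw [matS1_eq_conj]
  exact ((fixesFactors_matS2 l m).conj fixes_matS1 matS1_mul_self).conj fixes_matS2 matS2_mul_self

/-- A Coxeter element, in the coordinates in which `f₁`, `f₂`, `f₃` are invariant. -/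
noncomputable def matCox : Matrix (Fin 4) (Fin 4) ℂ := matS1 * matS2 * (matR * sgn 3)

theorem matCox_eq : matCox =
    !![-Complex.I / 2, Complex.I / 2, 1 / 2, -1 / 2;
      1 / 2, 1 / 2, Complex.I / 2, Complex.I / 2;
      1 / 2, 1 / 2, -Complex.I / 2, -Complex.I / 2;
      Complex.I / 2, -Complex.I / 2, 1 / 2, -1 / 2] := by
  rw [matCox, matR_mul_sgn]
  ext i j
  fin_cases i <;> fin_cases j <;>
    simp [matS1, matS2, Matrix.mul_apply, Fin.sum_univ_four, Matrix.cons_val]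

theorem matCox_sq : matCox * matCox =
    !![0, (1 + Complex.I) / 2, -(1 + Complex.I) / 2, 0;
      0, (1 + Complex.I) / 2, (1 + Complex.I) / 2, 0;
      (1 - Complex.I) / 2, 0, 0, (-1 + Complex.I) / 2;
      (1 - Complex.I) / 2, 0, 0, (1 - Complex.I) / 2] := by
  rw [matCox_eq]
  ext i j
  fin_cases i <;> fin_cases j <;>
    simp [Matrix.mul_apply, Fin.sum_univ_four, Matrix.cons_val] <;>
    linear_combination (norm := ring_nf) <;>
    simp [Complex.I_sq]

theorem matCox_pow_four : matCox * matCox * (matCox * matCox) =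
    !![-1 / 2, Complex.I / 2, Complex.I / 2, 1 / 2;
      1 / 2, Complex.I / 2, Complex.I / 2, -1 / 2;
      Complex.I / 2, 1 / 2, -1 / 2, Complex.I / 2;
      -Complex.I / 2, 1 / 2, -1 / 2, -Complex.I / 2] := by
  rw [matCox_sq]
  ext i j
  fin_cases i <;> fin_cases j <;>
    simp [Matrix.mul_apply, Fin.sum_univ_four, Matrix.cons_val] <;>
    linear_combination (norm := ring_nf) <;>
    simp [Complex.I_sq]

/-- A scalar of order 4 among the products of reflections: invariance under it forces the degree of
a nonzero form to be a multiple of 4. -/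
theorem matCox_pow_five :
    matCox * matCox * (matCox * matCox) * matCox = Complex.I • (1 : Matrix (Fin 4) (Fin 4) ℂ) := by
  rw [matCox_pow_four, matCox_eq]
  ext i j
  fin_cases i <;> fin_cases j <;>
    simp [Matrix.mul_apply, Fin.sum_univ_four, Matrix.cons_val] <;>
    linear_combination (norm := ring_nf)

theorem fixesFactors_matCox (l m : ℂ) : FixesFactors l m matCox :=
  ((fixesFactors_matS1 l m).mul (fixesFactors_matS2 l m)).mul
    ((fixesFactors_matR l m).mul (fixesFactors_sgn l m))

theorem three_dvd_of_cube_root {w : ℂ} (hw : w ^ 2 + w + 1 = 0) {d : ℕ}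
    (h : (w ^ 2) ^ d = 1) : 3 ∣ d := by
  have h3 : (w ^ 2) ^ 3 = 1 := by linear_combination (w ^ 3 + 1) * (w - 1) * hw
  have h1 : w ^ 2 ≠ 1 := by
    intro h
    have : w = -2 := by linear_combination hw - h
    rw [this] at h
    norm_num at h
  exact (orderOf_eq_prime h3 h1) ▸ orderOf_dvd_of_pow_eq_one h

theorem four_dvd_of_I_pow {d : ℕ} (h : Complex.I ^ d = 1) : 4 ∣ d := by
  have : orderOf Complex.I = 4 :=
    orderOf_eq_prime_pow (p := 2) (n := 1) (by norm_num [Complex.ext_iff]) (by norm_num [Complex.I_pow_four])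
  exact this ▸ orderOf_dvd_of_pow_eq_one h

theorem twelve_dvd_of_isHomogeneous (hp : Irreducible p) (hpF : p ∣ dodecic l m) {d : ℕ}
    (hd : p.IsHomogeneous d) : 12 ∣ d := by
  obtain ⟨w, hw⟩ := exists_cube_root
  have h0 := eval_ne_zero_of_dvd_last hpF hw
  -- The product of the two transpositions cyclically permutes the first three coordinates, and `(1,
  -- w, w², 0)` is an eigenvector with eigenvalue `w²`.
  have h3 : 3 ∣ d := by
    refine three_dvd_of_cube_root hw (mul_right_cancel₀ h0 ?_)
    rw [← hd.eval_smul_eq, one_mul]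
    nth_rewrite 2 [← ((fixesFactors_matS1 l m).mul (fixesFactors_matS2 l m)) p hp hpF]
    rw [eval_matSubst, ← Matrix.mulVec_mulVec, ← swp_zero_one, ← swp_one_two, swp_mulVec_four,
      swp_mulVec_four]
    have hw3 : w ^ 3 = 1 := by linear_combination (w - 1) * hw
    congr 2
    funext i
    fin_cases i <;> simp [Equiv.swap_apply_def]
    · linear_combination hw3
    · linear_combination w * hw3
  have h4 : 4 ∣ d := by
    refine four_dvd_of_I_pow (mul_right_cancel₀ h0 ?_)
    have hc := fixesFactors_matCox l m
    rw [← hd.eval_smul_eq, one_mul]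
    nth_rewrite 2 [← (((hc.mul hc).mul (hc.mul hc)).mul hc) p hp hpF]
    rw [eval_matSubst, matCox_pow_five, Matrix.smul_mulVec, Matrix.one_mulVec]
    rfl
  exact (Nat.Coprime.mul_dvd_of_dvd_of_dvd (by norm_num) h3 h4 : 3 * 4 ∣ d)

/-- The invariant dodecics are irreducible. -/
theorem dodecic_irreducible (l m : ℂ) : Irreducible (dodecic l m) := by
  have hu : ¬ IsUnit (dodecic l m) := by
    intro h
    obtain ⟨c, -, hc⟩ := isUnit_iff_eq_C_of_isReduced.1 h
    have h0 := (dodecic_isHomogeneous l m).inj_right (hc ▸ isHomogeneous_C _ c)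
      (dodecic_ne_zero l m)
    norm_num at h0
  obtain ⟨p, hp, q, hq⟩ := WfDvdMonoid.exists_irreducible_factor hu (dodecic_ne_zero l m)
  obtain ⟨d, hd0, hd⟩ := exists_isHomogeneous_of_dvd hp ⟨q, hq⟩
  obtain ⟨a, e, ha, he, hae⟩ := (hq ▸ dodecic_isHomogeneous l m).exists_of_mul
    (hq ▸ dodecic_ne_zero l m)
  obtain rfl : a = d := ha.inj_right hd hp.ne_zero
  have hd12 := twelve_dvd_of_isHomogeneous hp ⟨q, hq⟩ hd
  -- The degree of `p` is a positive multiple of 12 and at most 12, so the cofactor is constant.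
  obtain rfl : e = 0 := by omega
  obtain ⟨c, rfl⟩ : ∃ c, q = C c :=
    ⟨_, totalDegree_eq_zero_iff_eq_C.1 ((totalDegree_zero_iff_isHomogeneous _).2 he)⟩
  have hc : c ≠ 0 := by
    rintro rfl
    exact dodecic_ne_zero l m (by rw [hq, map_zero, mul_zero])
  rw [hq]
  exact (irreducible_mul_isUnit ((isUnit_iff_ne_zero.2 hc).map C)).2 hp

end G29

/-! ### Coefficients under monomial symmetries -/

section MonomialSubstitution

/-- The exponent vector `(a, b, c, d)`. -/
noncomputable def expFour (a b c d : ℕ) : Fin 4 →₀ ℕ := Finsupp.equivFunOnFinite.symm ![a, b, c, d]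

theorem prod_pow_expFour (v : Fin 4 → ℂ) (a b c d : ℕ) :
    ∏ i, v i ^ expFour a b c d i = v 0 ^ a * v 1 ^ b * v 2 ^ c * v 3 ^ d := by
  simp [Fin.prod_univ_four, expFour]

/-- Invariance of a polynomial under a monomial substitution, in terms of coefficients. -/
theorem coeff_mapDomain_of_eval_eq {F : MvPolynomial (Fin 4) ℂ} (s : Equiv.Perm (Fin 4))
    (k : Fin 4 → ℂ) (h : ∀ v, eval (fun i => k i * v (s i)) F = eval v F) (e : Fin 4 →₀ ℕ) :
    coeff (e.mapDomain s) F = (∏ i, k i ^ e i) * coeff e F := by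
  have hF : aeval (fun i => C (k i) * X (s i)) F = F := by
    refine MvPolynomial.funext fun v => ?_
    rw [← h v, ← coe_aeval_eq_eval, ← coe_aeval_eq_eval]
    simp only [RingHom.coe_coe]
    rw [← AlgHom.comp_apply, comp_aeval]
    simp
  conv_lhs => rw [← hF]
  clear h hF
  induction F using MvPolynomial.induction_on' with
  | monomial m a =>
    have : aeval (fun i => C (k i) * X (s i)) (monomial m a) =
        monomial (m.mapDomain s) ((∏ i, k i ^ m i) * a) := by
      rw [aeval_monomial, Finsupp.prod_fintype _ _ (by simp)]
      simp only [mul_pow, Finset.prod_mul_distrib, ← map_pow, ← map_prod]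
      rw [← rename_monomial, monomial_eq, Finsupp.prod_fintype _ _ (by simp)]
      simp only [map_mul, map_prod, map_pow, rename_X, rename_C, algebraMap_eq]
      ring
    rw [this, coeff_monomial, coeff_monomial]
    by_cases hm : m = e
    · rw [hm, if_pos rfl, if_pos rfl]
    · rw [if_neg hm, if_neg fun h => hm (Finsupp.mapDomain_injective s.injective h), mul_zero]
  | add p q hp hq => rw [map_add, coeff_add, coeff_add, hp, hq, mul_add]

theorem mapDomain_expFour (s : Equiv.Perm (Fin 4)) (a b c d : ℕ) :
    (expFour a b c d).mapDomain s = Finsupp.equivFunOnFinite.symm (![a, b, c, d] ∘ s.symm) := by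
  ext i
  rw [Finsupp.mapDomain_equiv_apply]
  rfl

end MonomialSubstitution

section SumAntidiagonalTuple

theorem sum_antidiagonalTuple_four_three (f : (Fin 4 → ℕ) → ℂ) :
    ∑ k ∈ Finset.Nat.antidiagonalTuple 4 3, f k =
      f ![3, 0, 0, 0] + f ![0, 3, 0, 0] + f ![0, 0, 3, 0] + f ![0, 0, 0, 3] +
      (f ![2, 1, 0, 0] + f ![2, 0, 1, 0] + f ![2, 0, 0, 1] + f ![1, 2, 0, 0] + f ![0, 2, 1, 0] +
        f ![0, 2, 0, 1] + f ![1, 0, 2, 0] + f ![0, 1, 2, 0] + f ![0, 0, 2, 1] + f ![1, 0, 0, 2] +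
        f ![0, 1, 0, 2] + f ![0, 0, 1, 2]) +
      (f ![1, 1, 1, 0] + f ![1, 1, 0, 1] + f ![1, 0, 1, 1] + f ![0, 1, 1, 1]) := by
  change (Multiset.map f (List.Nat.antidiagonalTuple 4 3 : Multiset (Fin 4 → ℕ))).sum = _
  rw [show List.Nat.antidiagonalTuple 4 3 = [![0, 0, 0, 3], ![0, 0, 1, 2], ![0, 0, 2, 1],
    ![0, 0, 3, 0], ![0, 1, 0, 2], ![0, 1, 1, 1], ![0, 1, 2, 0], ![0, 2, 0, 1], ![0, 2, 1, 0],
    ![0, 3, 0, 0], ![1, 0, 0, 2], ![1, 0, 1, 1], ![1, 0, 2, 0], ![1, 1, 0, 1], ![1, 1, 1, 0],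
    ![1, 2, 0, 0], ![2, 0, 0, 1], ![2, 0, 1, 0], ![2, 1, 0, 0], ![3, 0, 0, 0]] by decide]
  rw [Multiset.map_coe, Multiset.sum_coe]
  simp only [List.map_cons, List.map_nil, List.sum_cons, List.sum_nil]
  ring

theorem sum_antidiagonalTuple_four_two (f : (Fin 4 → ℕ) → ℂ) :
    ∑ k ∈ Finset.Nat.antidiagonalTuple 4 2, f k =
      f ![2, 0, 0, 0] + f ![0, 2, 0, 0] + f ![0, 0, 2, 0] + f ![0, 0, 0, 2] +
      (f ![1, 1, 0, 0] + f ![1, 0, 1, 0] + f ![1, 0, 0, 1] + f ![0, 1, 1, 0] + f ![0, 1, 0, 1] +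
        f ![0, 0, 1, 1]) := by
  change (Multiset.map f (List.Nat.antidiagonalTuple 4 2 : Multiset (Fin 4 → ℕ))).sum = _
  rw [show List.Nat.antidiagonalTuple 4 2 = [![0, 0, 0, 2], ![0, 0, 1, 1], ![0, 0, 2, 0],
    ![0, 1, 0, 1], ![0, 1, 1, 0], ![0, 2, 0, 0], ![1, 0, 0, 1], ![1, 0, 1, 0], ![1, 1, 0, 0],
    ![2, 0, 0, 0]] by decide]
  rw [Multiset.map_coe, Multiset.sum_coe]
  simp only [List.map_cons, List.map_nil, List.sum_cons, List.sum_nil]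
  ring

theorem sum_antidiagonalTuple_four_one (f : (Fin 4 → ℕ) → ℂ) :
    ∑ k ∈ Finset.Nat.antidiagonalTuple 4 1, f k =
      f ![1, 0, 0, 0] + f ![0, 1, 0, 0] + f ![0, 0, 1, 0] + f ![0, 0, 0, 1] := by
  change (Multiset.map f (List.Nat.antidiagonalTuple 4 1 : Multiset (Fin 4 → ℕ))).sum = _
  rw [show List.Nat.antidiagonalTuple 4 1 = [![0, 0, 0, 1], ![0, 0, 1, 0], ![0, 1, 0, 0],
    ![1, 0, 0, 0]] by decide]
  rw [Multiset.map_coe, Multiset.sum_coe]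
  simp only [List.map_cons, List.map_nil, List.sum_cons, List.sum_nil]
  ring

theorem sum_antidiagonalTuple_four_zero (f : (Fin 4 → ℕ) → ℂ) :
    ∑ k ∈ Finset.Nat.antidiagonalTuple 4 0, f k = f ![0, 0, 0, 0] := by
  change (Multiset.map f (List.Nat.antidiagonalTuple 4 0 : Multiset (Fin 4 → ℕ))).sum = _
  rw [show List.Nat.antidiagonalTuple 4 0 = [![0, 0, 0, 0]] by decide]
  simp

end SumAntidiagonalTuple

/-! ### Invariant forms of degree 12 -/

namespace G29

variable {F : MvPolynomial (Fin 4) ℂ}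

theorem eval_mulVec_of_mem (hF : F ∈ polyInvariants group) {g : GL (Fin 4) ℂ}
    (hg : g ∈ ({s1, s2, s3, s4} : Set (GL (Fin 4) ℂ))) (v : Fin 4 → ℂ) :
    eval ((g : Matrix (Fin 4) (Fin 4) ℂ).mulVec v) F = eval v F := by
  have := mem_polyInvariants.1 hF g (Subgroup.subset_closure hg)
  rw [linSubst_eq_matSubst] at this
  rw [← eval_matSubst, this]

theorem matS4_mulVec (x y z t : ℂ) : matS4.mulVec ![x, y, z, t] =
    ![(x - y - z - t) / 2, (-x + y - z - t) / 2, (-x - y + z - t) / 2,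
      (-x - y - z + t) / 2] := by
  rw [mulVec_four]
  ext i
  fin_cases i <;> simp [matS4] <;> ring

theorem eval_swap_zero_one (hF : F ∈ polyInvariants group) (x y z t : ℂ) :
    eval ![y, x, z, t] F = eval ![x, y, z, t] F := by
  have := eval_mulVec_of_mem hF (g := s1) (by simp) ![x, y, z, t]
  change eval (matS1.mulVec _) F = _ at this
  rwa [← swp_zero_one, swp_zero_one_mulVec] at this

theorem eval_swap_one_two (hF : F ∈ polyInvariants group) (x y z t : ℂ) :
    eval ![x, z, y, t] F = eval ![x, y, z, t] F := by
  have := eval_mulVec_of_mem hF (g := s2) (by simp) ![x, y, z, t]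
  change eval (matS2.mulVec _) F = _ at this
  rwa [← swp_one_two, swp_mulVec_four] at this

theorem eval_matS3 (hF : F ∈ polyInvariants group) (x y z t : ℂ) :
    eval ![-Complex.I * y, Complex.I * x, z, t] F = eval ![x, y, z, t] F := by
  have := eval_mulVec_of_mem hF (g := s3) (by simp) ![x, y, z, t]
  rwa [s3, matS3_mulVec] at this

theorem eval_matS4 (hF : F ∈ polyInvariants group) (x y z t : ℂ) :
    eval ![(x - y - z - t) / 2, (-x + y - z - t) / 2, (-x - y + z - t) / 2,
    (-x - y - z + t) / 2] F = eval ![x, y, z, t] F := by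
  have := eval_mulVec_of_mem hF (g := s4) (by simp) ![x, y, z, t]
  rwa [s4, matS4_mulVec] at this

/-- The product of `s1` and `s3` is a diagonal matrix with entries `i`, `-i`, 1, 1 up to order; it
governs exponents modulo 4. -/
theorem eval_diag (hF : F ∈ polyInvariants group) (x y z t : ℂ) :
    eval ![Complex.I * x, -Complex.I * y, z, t] F = eval ![x, y, z, t] F := by
  rw [← eval_swap_zero_one hF, eval_matS3 hF]

theorem eval_neg_swap_zero_one (hF : F ∈ polyInvariants group) (x y z t : ℂ) :
    eval ![-y, -x, z, t] F = eval ![x, y, z, t] F := by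
  have h := eval_diag hF (Complex.I * y) (-Complex.I * x) z t
  rw [← eval_swap_zero_one hF x y, ← eval_diag hF y x, ← h]
  congr 2
  ext i
  fin_cases i <;> simp [← mul_assoc]

theorem eval_neg_swap_one_two (hF : F ∈ polyInvariants group) (x y z t : ℂ) :
    eval ![x, -z, -y, t] F = eval ![x, y, z, t] F := by
  rw [eval_swap_zero_one hF (-z) x, eval_swap_one_two hF (-z) (-y), eval_neg_swap_zero_one hF,
    eval_swap_one_two hF y x, eval_swap_zero_one hF]

/-- Conjugating the reflection `y ↔ -z` by `s4` gives `x ↔ -t`, a monomial symmetry that involves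
the fourth coordinate. -/
theorem eval_neg_swap_zero_three (hF : F ∈ polyInvariants group) (x y z t : ℂ) :
    eval ![-t, y, z, -x] F = eval ![x, y, z, t] F := by
  have h := eval_matS4 hF ((x - y - z - t) / 2) (-((-x - y + z - t) / 2))
    (-((-x + y - z - t) / 2)) ((-x - y - z + t) / 2)
  refine Eq.trans ?_ (h.trans ((eval_neg_swap_one_two hF _ _ _ _).trans (eval_matS4 hF x y z t)))
  congr 2
  ext i
  fin_cases i <;> simp <;> ring

theorem expFour_eta (e : Fin 4 →₀ ℕ) : expFour (e 0) (e 1) (e 2) (e 3) = e := by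
  ext i
  fin_cases i <;> rfl

/-- The coefficient of the monomial with exponents `r + 4 * a`, `r + 4 * b`, … -/
noncomputable def blockCoeff (F : MvPolynomial (Fin 4) ℂ) (r : ℕ) (k : Fin 4 → ℕ) : ℂ :=
  coeff (expFour (r + 4 * k 0) (r + 4 * k 1) (r + 4 * k 2) (r + 4 * k 3)) F

section Coefficients

theorem coeff_of_eval_eq {k0 k1 k2 k3 : ℂ} (s : Equiv.Perm (Fin 4))
    (h : ∀ v : Fin 4 → ℂ, eval ![k0 * v (s 0), k1 * v (s 1), k2 * v (s 2), k3 * v (s 3)] F =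
      eval v F) (a b c d : ℕ) :
    coeff ((expFour a b c d).mapDomain s) F =
      k0 ^ a * k1 ^ b * k2 ^ c * k3 ^ d * coeff (expFour a b c d) F := by
  rw [coeff_mapDomain_of_eval_eq s ![k0, k1, k2, k3], prod_pow_expFour]
  · rfl
  · intro v
    rw [← h v]
    congr 2
    ext i
    fin_cases i <;> rfl

theorem eval_eq_of_forall {f : (Fin 4 → ℂ) → (Fin 4 → ℂ)}
    (h : ∀ x y z t, eval (f ![x, y, z, t]) F = eval ![x, y, z, t] F) (v : Fin 4 → ℂ) :
    eval (f v) F = eval v F := by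
  have : v = ![v 0, v 1, v 2, v 3] := by ext i; fin_cases i <;> rfl
  rw [this]
  exact h _ _ _ _

theorem coeff_swap_zero_one (hF : F ∈ polyInvariants group) (a b c d : ℕ) :
    coeff (expFour b a c d) F = coeff (expFour a b c d) F := by
  have := coeff_of_eval_eq (F := F) (k0 := 1) (k1 := 1) (k2 := 1) (k3 := 1) (Equiv.swap 0 1)
    (eval_eq_of_forall fun x y z t => by
      simpa [Equiv.swap_apply_def] using eval_swap_zero_one hF x y z t) a b c d
  rw [mapDomain_expFour] at this
  simp only [one_pow, one_mul] at this
  rw [← this, expFour]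
  congr 2
  ext i; fin_cases i <;> rfl

theorem coeff_swap_one_two (hF : F ∈ polyInvariants group) (a b c d : ℕ) :
    coeff (expFour a c b d) F = coeff (expFour a b c d) F := by
  have := coeff_of_eval_eq (F := F) (k0 := 1) (k1 := 1) (k2 := 1) (k3 := 1) (Equiv.swap 1 2)
    (eval_eq_of_forall fun x y z t => by
      simpa [Equiv.swap_apply_def] using eval_swap_one_two hF x y z t) a b c d
  rw [mapDomain_expFour] at this
  simp only [one_pow, one_mul] at this
  rw [← this, expFour]
  congr 2
  ext i; fin_cases i <;> rfl

theorem coeff_swap_zero_three (hF : F ∈ polyInvariants group) (a b c d : ℕ) :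
   
    coeff (expFour d b c a) F = (-1) ^ (a + d) * coeff (expFour a b c d) F := by
  have := coeff_of_eval_eq (F := F) (k0 := -1) (k1 := 1) (k2 := 1) (k3 := -1) (Equiv.swap 0 3)
    (eval_eq_of_forall fun x y z t => by
      simpa [Equiv.swap_apply_def] using eval_neg_swap_zero_three hF x y z t) a b c d
  rw [mapDomain_expFour] at this
  rw [pow_add]
  simp only [one_pow, mul_one] at this
  rw [← this, expFour]
  congr 2
  ext i; fin_cases i <;> rfl

theorem modEq_of_coeff_ne_zero (hF : F ∈ polyInvariants group) {a b c d : ℕ}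
    (h : coeff (expFour a b c d) F ≠ 0) : a % 4 = b % 4 := by
  have := coeff_of_eval_eq (F := F) (k0 := Complex.I) (k1 := -Complex.I) (k2 := 1) (k3 := 1)
    (Equiv.refl _) (eval_eq_of_forall fun x y z t => by
      simpa using eval_diag hF x y z t) a b c d
  rw [mapDomain_expFour, ← Complex.I_pow_three, ← pow_mul, ← pow_add] at this
  simp only [one_pow, mul_one] at this
  have h1 : Complex.I ^ (a + 3 * b) = 1 := by
    refine mul_right_cancel₀ h ?_
    rw [one_mul]
    exact this.symm
  have := four_dvd_of_I_pow h1
  omega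

theorem blockCoeff_swap_zero_one (hF : F ∈ polyInvariants group) (a b c d r : ℕ) :
    blockCoeff F r ![b, a, c, d] = blockCoeff F r ![a, b, c, d] :=
  coeff_swap_zero_one hF _ _ _ _

theorem blockCoeff_swap_one_two (hF : F ∈ polyInvariants group) (a b c d r : ℕ) :
    blockCoeff F r ![a, c, b, d] = blockCoeff F r ![a, b, c, d] :=
  coeff_swap_one_two hF _ _ _ _

/-- Exponents in a block are congruent modulo 4, so the sum of two of them is even and the sign of
`coeff_swap_zero_three` disappears. -/
theorem blockCoeff_swap_zero_three (hF : F ∈ polyInvariants group) (a b c d r : ℕ) :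
    blockCoeff F r ![d, b, c, a] = blockCoeff F r ![a, b, c, d] := by
  refine (coeff_swap_zero_three hF _ _ _ _).trans ?_
  rw [Even.neg_one_pow, one_mul]
  · rfl
  · simp only [Matrix.cons_val]
    exact ⟨r + 2 * a + 2 * d, by ring⟩

theorem blockCoeff_swap_two_three (hF : F ∈ polyInvariants group) (a b c d r : ℕ) :
    blockCoeff F r ![a, b, d, c] = blockCoeff F r ![a, b, c, d] := by
  rw [← blockCoeff_swap_one_two hF, ← blockCoeff_swap_zero_one hF,
    ← blockCoeff_swap_zero_three hF, blockCoeff_swap_zero_one hF, blockCoeff_swap_one_two hF,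
    ← blockCoeff_swap_zero_one hF, ← blockCoeff_swap_one_two hF,
    blockCoeff_swap_zero_three hF]

end Coefficients

/-- An invariant form of degree `12` as a sum over its monomials: their exponents are congruent to
each other modulo `4`. -/
theorem eval_eq_sum_blockCoeff (hF : F ∈ polyInvariants group) (h12 : F.IsHomogeneous 12)
    (v : Fin 4 → ℂ) : eval v F = ∑ r ∈ Finset.range 4,
      ∑ k ∈ Finset.Nat.antidiagonalTuple 4 (3 - r), blockCoeff F r k *
        (v 0 ^ (r + 4 * k 0) * v 1 ^ (r + 4 * k 1) * v 2 ^ (r + 4 * k 2) * v 3 ^ (r + 4 * k 3)) := by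
  have hm : ∀ e ∈ F.support, e 0 % 4 = e 1 % 4 ∧ e 0 % 4 = e 2 % 4 ∧ e 0 % 4 = e 3 % 4 ∧
      e 0 + e 1 + e 2 + e 3 = 12 := by
    intro e he
    have hs : e 0 + e 1 + e 2 + e 3 = 12 := by
      have := h12 (mem_support_iff.1 he)
      rw [Finsupp.weight_apply, Finsupp.sum_fintype _ _ (by simp), Fin.sum_univ_four] at this
      simpa using this
    have hc : coeff (expFour (e 0) (e 1) (e 2) (e 3)) F ≠ 0 := by
      rw [expFour_eta]; exact mem_support_iff.1 he
    have h1 := modEq_of_coeff_ne_zero hF hc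
    rw [← coeff_swap_one_two hF] at hc
    have h2 := modEq_of_coeff_ne_zero hF hc
    omega
  rw [Finset.sum_sigma', eval_eq']
  -- An exponent vector is split into its common residue `r` modulo 4 and its quotients, whose sum
  -- is `3 - r` because the degree is 12.
  refine Finset.sum_of_injOn (fun e => ⟨e 0 % 4, fun i => e i / 4⟩) ?_ ?_ ?_ ?_
  · intro e he e' he' h
    obtain ⟨h0, h1⟩ := Sigma.mk.inj h
    have h1 := congrFun (eq_of_heq h1)
    have k := hm e he
    have k' := hm e' he'
    ext i
    have := h1 i
    fin_cases i <;> simp at this ⊢ <;> omega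
  · intro e he
    have k := hm e he
    simp only [Finset.coe_sigma, Set.mem_sigma_iff, Finset.mem_coe, Finset.mem_range,
      Finset.Nat.mem_antidiagonalTuple, Fin.sum_univ_four]
    omega
  · rintro ⟨r, k⟩ hrk hi
    rw [Finset.mem_sigma, Finset.mem_range] at hrk
    have : blockCoeff F r k = 0 := by
      by_contra hne
      refine hi ⟨_, mem_support_iff.2 hne, ?_⟩
      have h4 : ∀ i, (r + 4 * i) / 4 = i := fun i => by have := hrk.1; dsimp at this; omega
      refine Sigma.ext ?_ (heq_of_eq (funext fun i => ?_))
      · have := hrk.1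
        simp [expFour] at this ⊢
        omega
      · fin_cases i <;> simp [expFour, h4]
    rw [this, zero_mul]
  · intro e he
    have k := hm e he
    have h4 : ∀ i, e 0 % 4 + 4 * (e i / 4) = e i := fun i => by fin_cases i <;> simp <;> omega
    simp only [blockCoeff, h4, expFour_eta, Fin.prod_univ_four]

/-- An invariant form of degree `12`, in terms of the elementary symmetric polynomials in the fourth
powers and of the product of the coordinates. -/
theorem exists_eval_eq (hF : F ∈ polyInvariants group) (h12 : F.IsHomogeneous 12) :
    ∃ a b c d g h j : ℂ, ∀ x y z t, eval ![x, y, z, t] F =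
      a * E1 x y z t ^ 3 + b * (E1 x y z t * E2 x y z t) + c * E3 x y z t +
      (x * y * z * t) * (d * E1 x y z t ^ 2 + g * E2 x y z t) +
      h * ((x * y * z * t) ^ 2 * E1 x y z t) + j * (x * y * z * t) ^ 3 := by
  -- The constants convert monomial symmetric functions into elementary ones, as in `Σ X³ = E1³ - 3
  -- E1 E2 + 3 E3`, `Σ X² Y = E1 E2 - 3 E3` and `Σ X² = E1² - 2 E2`.
  refine ⟨blockCoeff F 0 ![0, 0, 0, 3],
    -3 * blockCoeff F 0 ![0, 0, 0, 3] + blockCoeff F 0 ![0, 0, 1, 2],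
    3 * blockCoeff F 0 ![0, 0, 0, 3] - 3 * blockCoeff F 0 ![0, 0, 1, 2] +
      blockCoeff F 0 ![0, 1, 1, 1],
    blockCoeff F 1 ![0, 0, 0, 2],
    -2 * blockCoeff F 1 ![0, 0, 0, 2] + blockCoeff F 1 ![0, 0, 1, 1],
    blockCoeff F 2 ![0, 0, 0, 1], blockCoeff F 3 ![0, 0, 0, 0], fun x y z t => ?_⟩
  rw [eval_eq_sum_blockCoeff hF h12]
  simp only [Finset.sum_range_succ, Finset.sum_range_zero, zero_add, Nat.sub_zero,
    show 3 - 1 = 2 from rfl, show 3 - 2 = 1 from rfl, show 3 - 3 = 0 from rfl,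
    sum_antidiagonalTuple_four_three, sum_antidiagonalTuple_four_two,
    sum_antidiagonalTuple_four_one, sum_antidiagonalTuple_four_zero,
    blockCoeff_swap_zero_one hF 0 1, blockCoeff_swap_zero_one hF 0 2,
    blockCoeff_swap_zero_one hF 0 3, blockCoeff_swap_zero_one hF 1 2,
    blockCoeff_swap_one_two hF _ 0 1, blockCoeff_swap_one_two hF _ 0 2,
    blockCoeff_swap_one_two hF _ 0 3, blockCoeff_swap_one_two hF _ 1 2,
    blockCoeff_swap_two_three hF _ _ 0 1, blockCoeff_swap_two_three hF _ _ 0 2,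
    blockCoeff_swap_two_three hF _ _ 0 3, blockCoeff_swap_two_three hF _ _ 1 2,
    Matrix.cons_val, E1, E2, E3]
  ring

/-- The invariant forms of degree `12` are the combinations of the transforms of `f₃`, `f₂ f₁` and
`f₁³`. -/
theorem exists_eq_matSubst_matP (hF : F ∈ polyInvariants group) (h12 : F.IsHomogeneous 12) :
    ∃ c l m : ℂ, F = matSubst matP (C c * f3 + C l * (f2 * f1) + C m * f1 ^ 3) := by
  obtain ⟨a, b, c, d, g, h, j, hE⟩ := exists_eval_eq hF h12
  -- The monomial symmetries leave seven parameters. Invariance under `s4` at four points gives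
  -- linear relations that express `d`, `g`, `h`, `j` through `a`, `b`, `c`.
  have k1 := eval_matS4 hF 0 1 0 0
  have k2 := eval_matS4 hF 0 1 1 1
  have k3 := eval_matS4 hF 0 2 1 0
  have k4 := eval_matS4 hF 0 3 1 0
  rw [hE, hE] at k1 k2 k3 k4
  norm_num [E1, E2, E3] at k1 k2 k3 k4
  -- Modulo `xyzt`, the transforms of `f3`, `f2 f1` and `f1³` are `4 E3`, `-32 E1 E2` and `-8 E1³`;
  -- this dictates the three coefficients.
  refine ⟨c / 4, -b / 32, -a / 8, eval_four fun x y z t => ?_⟩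
  have hd : d = c / 4 + 2 * b - 36 * a := by
    linear_combination 565 / 6 * k1 + 2 / 9 * k2 + 13 / 450 * k3 - 1 / 2400 * k4
  have hg : g = -c - 12 * b := by
    linear_combination -1898 / 3 * k1 - 8 / 9 * k2 - 146 / 525 * k3 + 13 / 4200 * k4
  have hh : h = -c - 22 * b + 432 * a := by
    linear_combination -15392 / 9 * k1 - 32 / 63 * k3 + 1 / 126 * k4
  have hj : j = 2 * c - 24 * b - 1728 * a := by
    linear_combination -77828 / 9 * k1 + 16 / 9 * k2 - 52 / 63 * k3 + 5 / 252 * k4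
  rw [hE, hd, hg, hh, hj]
  simp only [map_add, map_mul, map_pow, algHom_C, algebraMap_eq, eval_C, eval_matP_f1,
    eval_matP_f2, eval_matP_f3]
  ring

/-! ### Fundamental invariants -/

/-- A fundamental invariant of degree `12` is irreducible. -/
theorem irreducible_of_isFundamentalInvariant (h : IsFundamentalInvariant group 12 F) :
    Irreducible F := by
  obtain ⟨h12, θ, hθ, i, rfl⟩ := h
  have hmem : ∀ f, f ∈ polyInvariants group ↔ ∃ P : MvPolynomial (Fin 4) ℂ, aeval θ P = f := by
    intro f
    rw [← hθ.adjoin_eq, Algebra.adjoin_range_eq_range_aeval]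
    rfl
  have hinj : Function.Injective (aeval θ : MvPolynomial (Fin 4) ℂ →ₐ[ℂ] _) :=
    hθ.algebraicIndependent
  have hF0 : θ i ≠ 0 := by
    intro h0
    exact X_ne_zero (R := ℂ) i (hinj (by rw [aeval_X, h0, map_zero]))
  obtain ⟨c, l, m, hc⟩ := exists_eq_matSubst_matP ((hmem _).2 ⟨X i, aeval_X _ _⟩) h12
  -- Without `f3` the invariant is a product of invariants of degrees 4 and 8. Algebraic
  -- independence turns this into a factorization of the variable `X i`, and a unit factor would
  -- have degree 0.
  by_cases hc0 : c = 0
  · exfalso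
    set q := matSubst matP (C l * f2 + C m * f1 ^ 2) with hq
    have hF : θ i = matSubst matP f1 * q := by
      rw [hc, hc0, hq, ← map_mul]
      congr 1
      rw [map_zero]
      ring
    have hqm : q ∈ polyInvariants group := by
      rw [hq, map_add, map_mul, map_mul, map_pow, algHom_C, algHom_C]
      exact add_mem (mul_mem (Subalgebra.algebraMap_mem _ _) matP_f2_mem)
        (mul_mem (Subalgebra.algebraMap_mem _ _) (pow_mem matP_f1_mem 2))
    have hqh : q.IsHomogeneous 8 :=
      IsHomogeneous.matSubst _ ((f2_isHomogeneous.C_mul l).add ((f1_isHomogeneous.pow 2).C_mul m))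
    have h1h : (matSubst matP f1).IsHomogeneous 4 := IsHomogeneous.matSubst _ f1_isHomogeneous
    obtain ⟨P, hP⟩ := (hmem _).1 matP_f1_mem
    obtain ⟨Q, hQ⟩ := (hmem _).1 hqm
    have hX : X i = P * Q := hinj (by rw [aeval_X, map_mul, hP, hQ, hF])
    have hunit : ∀ {P f : MvPolynomial (Fin 4) ℂ} {d : ℕ}, IsUnit P → aeval θ P = f →
        f.IsHomogeneous d → f ≠ 0 → d = 0 := by
      intro P f d hu hPf hf hf0
      obtain ⟨k, -, rfl⟩ := isUnit_iff_eq_C_of_isReduced.1 hu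
      rw [algHom_C, algebraMap_eq] at hPf
      exact hf.inj_right (hPf ▸ isHomogeneous_C _ k) hf0
    rcases (X_prime (R := ℂ) (i := i)).irreducible.isUnit_or_isUnit hX with hu | hu
    · exact absurd (hunit hu hP h1h (left_ne_zero_of_mul (hF ▸ hF0))) (by norm_num)
    · exact absurd (hunit hu hQ hqh (right_ne_zero_of_mul (hF ▸ hF0))) (by norm_num)
  · have hF : θ i = matSubst matP (C c * dodecic (l / c) (m / c)) := by
      rw [hc]
      congr 1
      rw [dodecic, mul_add, mul_add, ← mul_assoc (C c) (C _), ← mul_assoc (C c) (C _),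
        ← map_mul, ← map_mul,
        mul_div_cancel₀ _ hc0, mul_div_cancel₀ _ hc0]
    rw [hF, irreducible_matSubst_iff _ matP_mul_self]
    exact (irreducible_isUnit_mul ((isUnit_iff_ne_zero.2 hc0).map C)).2 (dodecic_irreducible _ _)

end G29

/-! ### Integrality of the projective spectrum -/

section ProjIntegral

open AlgebraicGeometry

variable {A : Type*} [CommRing A] [IsDomain A] {σ : Type*} [SetLike σ A] [AddSubgroupClass σ A]
  (𝒜 : ℕ → σ) [GradedRing 𝒜]

/-- The homogeneous localization embeds into the localization of a domain; these rings are the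
stalks of `Proj`. -/
theorem HomogeneousLocalization.atPrime_isReduced (P : Ideal A) [P.IsPrime] :
    _root_.IsReduced (HomogeneousLocalization.AtPrime 𝒜 P) :=
  isReduced_of_injective (algebraMap (HomogeneousLocalization.AtPrime 𝒜 P) (Localization.AtPrime P))
    (HomogeneousLocalization.val_injective _)

/-- The projective spectrum of a graded domain is reduced. -/
theorem AlgebraicGeometry.Proj.isReduced_of_isDomain : AlgebraicGeometry.IsReduced (Proj 𝒜) := by
  apply +allowSynthFailures isReduced_of_isReduced_stalk
  intro (x : ProjectiveSpectrum 𝒜)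
  have := HomogeneousLocalization.atPrime_isReduced 𝒜 x.asHomogeneousIdeal.toIdeal
  exact isReduced_of_injective (Proj.stalkIso 𝒜 x).hom.hom
    (Proj.stalkIso 𝒜 x).commRingCatIsoToRingEquiv.injective

/-- The generic point of the projective spectrum of a graded domain. -/
def ProjectiveSpectrum.generic (h : ¬ HomogeneousIdeal.irrelevant 𝒜 ≤ ⊥) :
    ProjectiveSpectrum 𝒜 :=
  ⟨⊥, by rw [HomogeneousIdeal.toIdeal_bot]; exact Ideal.isPrime_bot, h⟩

theorem ProjectiveSpectrum.irreducibleSpace_of_isDomain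
    (h : ¬ HomogeneousIdeal.irrelevant 𝒜 ≤ ⊥) : IrreducibleSpace (ProjectiveSpectrum 𝒜) := by
  have hc : closure {generic 𝒜 h} = Set.univ := Set.eq_univ_of_forall fun x =>
    (le_iff_mem_closure 𝒜 _ x).1 (bot_le : (⊥ : HomogeneousIdeal 𝒜) ≤ x.asHomogeneousIdeal)
  have : IsIrreducible (Set.univ : Set (ProjectiveSpectrum 𝒜)) :=
    hc ▸ isIrreducible_singleton.closure
  exact (irreducibleSpace_def _).2 this

end ProjIntegral

section Hypersurface

attribute [local instance] MvPolynomial.gradedAlgebra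

/-- The hypersurface of an irreducible form of degree greater than `1` is reduced and irreducible. -/
theorem hypersurface_isReduced_irreducibleSpace {n d : ℕ} {f : MvPolynomial (Fin n) ℂ}
    (hf : f.IsHomogeneous d) (hirr : Irreducible f) (hd : 1 < d) (i : Fin n) :
    AlgebraicGeometry.IsReduced (hypersurface f hf) ∧ IrreducibleSpace (hypersurface f hf) := by
  let := quotientGradedAlgebra (homogeneousSubmodule (Fin n) ℂ) (I := Ideal.span {f})
    (Ideal.homogeneous_span _ _ fun _ hx => ⟨d, by
      rw [Set.mem_singleton_iff.1 hx]; exact (mem_homogeneousSubmodule d f).2 hf⟩)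
  have : (Ideal.span {f}).IsPrime :=
    (Ideal.span_singleton_prime hirr.ne_zero).2 hirr.prime
  refine ⟨AlgebraicGeometry.Proj.isReduced_of_isDomain
    (quotientGrading (homogeneousSubmodule (Fin n) ℂ) (Ideal.span {f})),
    ProjectiveSpectrum.irreducibleSpace_of_isDomain
    (quotientGrading (homogeneousSubmodule (Fin n) ℂ) (Ideal.span {f})) fun hle => ?_⟩
  -- The irrelevant ideal is nonzero, so the zero ideal is a point of `Proj`: a variable has degree
  -- 1, hence is not a multiple of a form of degree greater than 1.
  have hX : Ideal.Quotient.mk (Ideal.span {f}) (X i) ∈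
      quotientGrading (homogeneousSubmodule (Fin n) ℂ) (Ideal.span {f}) 1 :=
    ⟨X i, (mem_homogeneousSubmodule 1 _).2 (isHomogeneous_X ℂ i), rfl⟩
  have h0 := hle (HomogeneousIdeal.mem_irrelevant_of_mem _ one_pos hX)
  obtain ⟨q, hq⟩ := Ideal.mem_span_singleton.1 (Ideal.Quotient.eq_zero_iff_mem.1 h0)
  have hle := congrArg totalDegree hq
  rw [totalDegree_X, totalDegree_mul_of_isDomain hirr.ne_zero, hf.totalDegree hirr.ne_zero] at hle
  · omega
  · rintro rfl
    exact X_ne_zero (R := ℂ) i (by rw [hq, mul_zero])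

end Hypersurface

theorem mainTheorem2 :
    (∀ F : MvPolynomial (Fin 4) ℂ,
      IsFundamentalInvariant G29.group 12 F → Irreducible F) ∧
    (∀ l m : ℂ,
      AlgebraicGeometry.IsReduced (G29.surface l m) ∧ IrreducibleSpace (G29.surface l m)) :=
  ⟨fun _ => G29.irreducible_of_isFundamentalInvariant, fun l m =>
    hypersurface_isReduced_irreducibleSpace (G29.dodecic_isHomogeneous l m)
      (G29.dodecic_irreducible l m) (by norm_num) 0⟩
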